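/- Let $(M,\omega)$ be a (finite-dimensional, Hausdorff) smooth symplectic manifold and let $\nabla$ be a smooth symplectic connection on it, i.e. a torsion-free affine connection with $\nabla\omega=0$. A symmetric normal neighborhood of $p\in M$ is a set $U=\exp_p(V)$, where $V\subseteq T_pM$ is an open star-shaped neighborhood of $0$ with $V=-V$, contained in the domain of $\exp_p$, such that $\exp_p:V\to U$ is a diffeomorphism onto an open set; the geodesic symmetry $s_p:U\to U$ is then defined by $s_p(\exp_p X)=\exp_p(-X)$ for $X\in V$. The connection $\nabla$ is of type S if every $p\in M$ has a symmetric normal neighborhood $U$ with $s_p^*(\omega|_U)=\omega|_U$. Let $R(X,Y)Z=\nabla_X\nabla_YZ-\nabla_Y\nabla_XZ-\nabla_{[X,Y]}Z$ and let $r(X,Y)=\operatorname{tr}\bigl(Z\mapsto R(X,Z)Y\bigr)$ be the Ricci tensor. If $\nabla$ is of type S, then $\nabla$ is preferred, i.e. its Ricci tensor is cyclic parallel: $$(\nabla_Xr)(Y,Z)+(\nabla_Yr)(Z,X)+(\nabla_Zr)(X,Y)=0\qquad\text{for all smooth vector fields }X,Y,Z.$$ In particular $(\nabla_Xr)(X,X)=0$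 for every smooth vector field $X$. -/

import Mathlib

open Bundle FiberBundle VectorField
open scoped Manifold ContDiff Topology

namespace SymplecticConnection

noncomputable section

section Definitions

variable {E : Type*} [NormedAddCommGroup E] [NormedSpace ℝ E] [FiniteDimensional ℝ E]
  {M : Type*} [TopologicalSpace M] [ChartedSpace E M] [IsManifold 𝓘(ℝ, E) ∞ M]

/-! ### Symplectic forms -/

/-- `Ω` is a symplectic form on `M`: a smooth, alternating, nondegenerate and closed 2-form.
The last field is `dΩ(X, Y, Z) = 0`, written with the invariant formula for the exterior
derivative. -/
structure IsSymplecticForm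
    (Ω : Π x : M, TangentSpace 𝓘(ℝ, E) x →L[ℝ] TangentSpace 𝓘(ℝ, E) x →L[ℝ] ℝ) : Prop where
  smooth : ContMDiff 𝓘(ℝ, E) (𝓘(ℝ, E).prod 𝓘(ℝ, E →L[ℝ] E →L[ℝ] ℝ)) ∞
    (fun x ↦ TotalSpace.mk' (E →L[ℝ] E →L[ℝ] ℝ)
      (E := fun x : M ↦ TangentSpace 𝓘(ℝ, E) x →L[ℝ] TangentSpace 𝓘(ℝ, E) x →L[ℝ] ℝ) x (Ω x))
  alternating : ∀ (x : M) (u : TangentSpace 𝓘(ℝ, E) x), Ω x u u = 0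
  nondegenerate : ∀ (x : M) (u : TangentSpace 𝓘(ℝ, E) x), (∀ v, Ω x u v = 0) → u = 0
  closed : ∀ X Y Z : Π x : M, TangentSpace 𝓘(ℝ, E) x,
    CMDiff ∞ (T% X) → CMDiff ∞ (T% Y) → CMDiff ∞ (T% Z) → ∀ x : M,
      mvfderiv 𝓘(ℝ, E) (fun y ↦ Ω y (Y y) (Z y)) x (X x)
        - mvfderiv 𝓘(ℝ, E) (fun y ↦ Ω y (X y) (Z y)) x (Y x)
        + mvfderiv 𝓘(ℝ, E) (fun y ↦ Ω y (X y) (Y y)) x (Z x)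
        - Ω x (mlieBracket 𝓘(ℝ, E) X Y x) (Z x)
        + Ω x (mlieBracket 𝓘(ℝ, E) X Z x) (Y x)
        - Ω x (mlieBracket 𝓘(ℝ, E) Y Z x) (X x) = 0

/-! ### Symplectic connections

As in Mathlib, `cov Y x (X x)` is the value at `x` of `∇_X Y`. -/

/-- A (smooth) affine connection is symplectic for `Ω` if it is torsion-free and `∇Ω = 0`. Its
smoothness is Mathlib's class `CovariantDerivative.ContMDiffCovariantDerivative`. -/
structure IsSymplecticConnection
    (Ω : Π x : M, TangentSpace 𝓘(ℝ, E) x →L[ℝ] TangentSpace 𝓘(ℝ, E) x →L[ℝ] ℝ)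
    (cov : CovariantDerivative 𝓘(ℝ, E) E (TangentSpace 𝓘(ℝ, E) : M → Type _)) : Prop where
  torsion_eq_zero : cov.torsion = 0
  parallel : ∀ X Y Z : Π x : M, TangentSpace 𝓘(ℝ, E) x,
    CMDiff ∞ (T% X) → CMDiff ∞ (T% Y) → CMDiff ∞ (T% Z) → ∀ x : M,
      mvfderiv 𝓘(ℝ, E) (fun y ↦ Ω y (Y y) (Z y)) x (X x)
        - Ω x (cov Y x (X x)) (Z x) - Ω x (Y x) (cov Z x (X x)) = 0

/-! ### Geodesics and the exponential map -/

/-- The velocity `γ'(t)` of a curve `γ` in `M`. -/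
def velocity (γ : ℝ → M) (t : ℝ) : TangentSpace 𝓘(ℝ, E) (γ t) :=
  mfderiv 𝓘(ℝ, ℝ) 𝓘(ℝ, E) γ t (1 : ℝ)

/-- The covariant derivative at time `t` of a vector field `V` along a curve `γ`. In the
trivialization of `TM` centered at `γ t`, with associated local frame `eᵢ`, one has
`V(s) = ∑ aᵢ(s) eᵢ(γ(s))` and `D V / dt = ∑ aᵢ'(t) eᵢ + ∑ aᵢ(t) ∇_{γ'(t)} eᵢ`. The section
`extend E (V t)` is `∑ aᵢ(t) eᵢ`, with the `aᵢ(t)` frozen. -/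
def covDerivAlong (cov : CovariantDerivative 𝓘(ℝ, E) E (TangentSpace 𝓘(ℝ, E) : M → Type _))
    (γ : ℝ → M) (V : Π t : ℝ, TangentSpace 𝓘(ℝ, E) (γ t)) (t : ℝ) :
    TangentSpace 𝓘(ℝ, E) (γ t) :=
  let e := trivializationAt E (TangentSpace 𝓘(ℝ, E) : M → Type _) (γ t)
  e.symm (γ t) (deriv (fun s ↦ (e ⟨γ s, V s⟩).2) t)
    + cov (extend E (V t)) (γ t) (velocity γ t)

/-- `γ` is a (smooth, affinely parametrized) geodesic on the open set of times `J`. -/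
def IsGeodesicOn (cov : CovariantDerivative 𝓘(ℝ, E) E (TangentSpace 𝓘(ℝ, E) : M → Type _))
    (γ : ℝ → M) (J : Set ℝ) : Prop :=
  ContMDiffOn 𝓘(ℝ, ℝ) 𝓘(ℝ, E) ∞ γ J ∧ ∀ t ∈ J, covDerivAlong cov γ (velocity γ) t = 0

/-- `γ` is a geodesic defined on an open interval containing `[0, 1]`, starting at `p` with
velocity `v`. -/
def IsUnitGeodesic (cov : CovariantDerivative 𝓘(ℝ, E) E (TangentSpace 𝓘(ℝ, E) : M → Type _))
    (p : M) (v : TangentSpace 𝓘(ℝ, E) p) (γ : ℝ → M) : Prop :=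
  (∃ ε > 0, IsGeodesicOn cov γ (Set.Ioo (-ε) (1 + ε))) ∧
    (⟨γ 0, velocity γ 0⟩ : TangentBundle 𝓘(ℝ, E) M) = ⟨p, v⟩

/-- The domain in `T_p M` of the exponential map at `p`. -/
def expDomain (cov : CovariantDerivative 𝓘(ℝ, E) E (TangentSpace 𝓘(ℝ, E) : M → Type _))
    (p : M) : Set (TangentSpace 𝓘(ℝ, E) p) :=
  {v | ∃ γ : ℝ → M, IsUnitGeodesic cov p v γ}

open Classical in
/-- The exponential map at `p`: `exp_p v = γ(1)` for the geodesic `γ` with `γ(0) = p` and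
`γ'(0) = v`; it takes the irrelevant value `p` outside `expDomain cov p`. -/
def expMap (cov : CovariantDerivative 𝓘(ℝ, E) E (TangentSpace 𝓘(ℝ, E) : M → Type _))
    (p : M) (v : TangentSpace 𝓘(ℝ, E) p) : M :=
  if h : ∃ γ : ℝ → M, IsUnitGeodesic cov p v γ then h.choose 1 else p

/-! ### Normal neighborhoods, geodesic symmetries and connections of type S -/

/-- A normal neighborhood `U` of `p`: the diffeomorphic image under `exp_p` of an open star-shaped
neighborhood `V` of `0` in `T_p M`. Here `V = diffeo.source`, `U = diffeo.target`, and `T_p M` is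
identified with the model space `E`, to which it is definitionally equal. -/
structure NormalNeighborhood
    (cov : CovariantDerivative 𝓘(ℝ, E) E (TangentSpace 𝓘(ℝ, E) : M → Type _)) (p : M) where
  /-- The diffeomorphism from `V` to `U` induced by the exponential map. -/
  diffeo : PartialDiffeomorph 𝓘(ℝ, E) 𝓘(ℝ, E) E M ∞
  zero_mem : (0 : E) ∈ diffeo.source
  starConvex : StarConvex ℝ (0 : E) diffeo.source
  subset_expDomain : ∀ v ∈ diffeo.source, v ∈ expDomain cov p
  eq_expMap : ∀ v ∈ diffeo.source, diffeo.toPartialEquiv v = expMap cov p v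

namespace NormalNeighborhood

variable {cov : CovariantDerivative 𝓘(ℝ, E) E (TangentSpace 𝓘(ℝ, E) : M → Type _)} {p : M}

/-- A normal neighborhood is symmetric if `V = -V`. -/
def IsSymmetric (N : NormalNeighborhood cov p) : Prop :=
  ∀ v : E, v ∈ N.diffeo.source → -v ∈ N.diffeo.source

/-- The geodesic symmetry `s_p`, with `s_p (exp_p v) = exp_p (-v)` for `v ∈ V`. It is a map from
`U` to `U` if the normal neighborhood is symmetric, and its values outside `U` are irrelevant. -/
def geodesicSymmetry (N : NormalNeighborhood cov p) (q : M) : M :=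
  N.diffeo.toPartialEquiv (-(N.diffeo.toPartialEquiv.symm q))

end NormalNeighborhood

/-- `cov` is of type S for `Ω`: every point has a symmetric normal neighborhood `U` such that
`s_p^* Ω = Ω` on `U`. -/
def IsTypeS
    (Ω : Π x : M, TangentSpace 𝓘(ℝ, E) x →L[ℝ] TangentSpace 𝓘(ℝ, E) x →L[ℝ] ℝ)
    (cov : CovariantDerivative 𝓘(ℝ, E) E (TangentSpace 𝓘(ℝ, E) : M → Type _)) : Prop :=
  ∀ p : M, ∃ N : NormalNeighborhood cov p, N.IsSymmetric ∧
    ∀ q ∈ N.diffeo.target, ∀ u v : TangentSpace 𝓘(ℝ, E) q,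
      Ω (N.geodesicSymmetry q)
        (mfderiv 𝓘(ℝ, E) 𝓘(ℝ, E) N.geodesicSymmetry q u)
        (mfderiv 𝓘(ℝ, E) 𝓘(ℝ, E) N.geodesicSymmetry q v) = Ω q u v

/-! ### Curvature, Ricci curvature and preferred connections -/

/-- The curvature `R(X, Y)Z = ∇_X ∇_Y Z - ∇_Y ∇_X Z - ∇_[X, Y] Z` on vector fields. -/
def curvature (cov : CovariantDerivative 𝓘(ℝ, E) E (TangentSpace 𝓘(ℝ, E) : M → Type _))
    (X Y Z : Π x : M, TangentSpace 𝓘(ℝ, E) x) (x : M) : TangentSpace 𝓘(ℝ, E) x :=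
  cov (fun y ↦ cov Z y (Y y)) x (X x) - cov (fun y ↦ cov Z y (X y)) x (Y x)
    - cov Z x (mlieBracket 𝓘(ℝ, E) X Y x)

end Definitions

section Ricci

theorem eventually_contMDiffAt_extend {E : Type*} [NormedAddCommGroup E] [NormedSpace ℝ E]
    {M : Type*} [TopologicalSpace M] [ChartedSpace E M] [IsManifold 𝓘(ℝ, E) ∞ M]
    {x : M} (w : TangentSpace 𝓘(ℝ, E) x) :
    ∀ᶠ y in 𝓝 x, CMDiffAt ∞ (T% (extend E w)) y := by
  obtain ⟨s, hs, h⟩ := exists_contMDiffOn_extend (k := ∞) 𝓘(ℝ, E) E w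
  filter_upwards [eventually_mem_nhds_iff.2 hs] with y hy
  exact h.contMDiffAt hy

variable {E : Type*} [NormedAddCommGroup E] [NormedSpace ℝ E] [FiniteDimensional ℝ E]
  {M : Type*} [TopologicalSpace M] [ChartedSpace E M] [IsManifold 𝓘(ℝ, E) ∞ M] [T2Space M]
  (cov : CovariantDerivative 𝓘(ℝ, E) E (TangentSpace 𝓘(ℝ, E) : M → Type _))

/-- A smooth connection maps a vector field that is smooth near `x` to a section differentiable
at `x`. -/
theorem mdifferentiableAt_cov [hcov : cov.ContMDiffCovariantDerivative ∞]
    {σ : Π x : M, TangentSpace 𝓘(ℝ, E) x} {x : M}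
    (hσ : ∀ᶠ y in 𝓝 x, CMDiffAt ∞ (T% σ) y) :
    MDifferentiableAt 𝓘(ℝ, E) (𝓘(ℝ, E).prod 𝓘(ℝ, E →L[ℝ] E))
      (fun y : M ↦ (⟨y, cov σ y⟩ : TotalSpace (E →L[ℝ] E)
        fun y : M ↦ TangentSpace 𝓘(ℝ, E) y →L[ℝ] TangentSpace 𝓘(ℝ, E) y)) x := by
  obtain ⟨u, hu, huo, hxu⟩ := eventually_nhds_iff.1 hσ
  obtain ⟨f, -, hf⟩ := (SmoothBumpFunction.nhds_basis_tsupport (I := 𝓘(ℝ, E)) x).mem_iff.1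
    (huo.mem_nhds hxu)
  have h1 : CMDiff ∞ (T% ((f : M → ℝ) • σ)) :=
    ContMDiffOn.smul_section_of_tsupport f.contMDiff.contMDiffOn huo hf
      fun y hy ↦ (hu y hy).contMDiffWithinAt
  have h2 := (hcov.contMDiff.contMDiff (σ := (f : M → ℝ) • σ) h1.contMDiffOn).contMDiffAt
    Filter.univ_mem (x := x)
  refine (h2.mdifferentiableAt (by simp)).congr_of_eventuallyEq ?_
  have h3 := f.eventuallyEq_one.eventually_nhds
  filter_upwards [h3, huo.mem_nhds hxu] with y hy hyu
  have : cov σ y = cov ((f : M → ℝ) • σ) y := by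
    refine cov.isCovariantDerivativeOn.congr_of_eventuallyEq
      ((hu y hyu).mdifferentiableAt (by simp)) (h1.contMDiffAt.mdifferentiableAt (by simp))
      (s := Set.univ) Filter.univ_mem ?_
    filter_upwards [hy] with z hz
    simp [hz]
  rw [this]

/-- `R(X, Y)Z` at `x` is tensorial in `Y`. -/
theorem curvature_tensorialAt [cov.ContMDiffCovariantDerivative ∞]
    {X Z : Π x : M, TangentSpace 𝓘(ℝ, E) x} {x : M}
    (hZ : ∀ᶠ y in 𝓝 x, CMDiffAt ∞ (T% Z) y) :
    TensorialAt 𝓘(ℝ, E) E (fun Y ↦ curvature cov X Y Z x) x := by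
  have hZ' := mdifferentiableAt_cov cov hZ
  have key : ∀ {Y : Π x : M, TangentSpace 𝓘(ℝ, E) x}, MDiffAt (T% Y) x →
      MDiffAt (T% (fun y ↦ cov Z y (Y y))) x := fun hY ↦
    hZ'.clm_bundle_apply hY
  have hcov := cov.isCovariantDerivativeOn (s := Set.univ)
  constructor
  · intro f Y hf hY
    have e : (fun y ↦ cov Z y ((f • Y) y)) = f • fun y ↦ cov Z y (Y y) := by
      ext y; simp
    simp only [curvature]
    rw [e, hcov.leibniz (key hY) hf, mlieBracket_smul_right hf hY]
    simp
    module
  · intro Y Y' hY hY'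
    have e : (fun y ↦ cov Z y ((Y + Y') y)) =
        (fun y ↦ cov Z y (Y y)) + fun y ↦ cov Z y (Y' y) := by
      ext y; simp
    simp only [curvature]
    rw [e, hcov.add (key hY) (key hY'), mlieBracket_add_right hY hY']
    simp
    module

/-- For `u, w ∈ T_x M`, the endomorphism `v ↦ R(u, v)w` of `T_x M`. -/
def curvatureEndo [cov.ContMDiffCovariantDerivative ∞] (x : M) (u w : TangentSpace 𝓘(ℝ, E) x) :
    TangentSpace 𝓘(ℝ, E) x →L[ℝ] TangentSpace 𝓘(ℝ, E) x :=
  TensorialAt.mkHom (fun Y ↦ curvature cov (extend E u) Y (extend E w) x) x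
    (curvature_tensorialAt cov (eventually_contMDiffAt_extend w))

/-- The Ricci tensor `r(u, w) = tr (v ↦ R(u, v)w)`. -/
def ricci [cov.ContMDiffCovariantDerivative ∞] (x : M) (u w : TangentSpace 𝓘(ℝ, E) x) : ℝ :=
  LinearMap.trace ℝ (TangentSpace 𝓘(ℝ, E) x) (curvatureEndo cov x u w).toLinearMap

/-- `(∇_X r)(Y, Z) = X(r(Y, Z)) - r(∇_X Y, Z) - r(Y, ∇_X Z)` for vector fields `X, Y, Z`. -/
def covDerivRicci [cov.ContMDiffCovariantDerivative ∞]
    (X Y Z : Π x : M, TangentSpace 𝓘(ℝ, E) x) (x : M) : ℝ :=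
  mvfderiv 𝓘(ℝ, E) (fun y ↦ ricci cov y (Y y) (Z y)) x (X x)
    - ricci cov x (cov Y x (X x)) (Z x) - ricci cov x (Y x) (cov Z x (X x))

/-- `cov` is preferred if its Ricci tensor is cyclic parallel:
`(∇_X r)(Y, Z) + (∇_Y r)(Z, X) + (∇_Z r)(X, Y) = 0` for all smooth vector fields. -/
def IsPreferred [cov.ContMDiffCovariantDerivative ∞] : Prop :=
  ∀ X Y Z : Π x : M, TangentSpace 𝓘(ℝ, E) x,
    CMDiff ∞ (T% X) → CMDiff ∞ (T% Y) → CMDiff ∞ (T% Z) → ∀ x : M,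
      covDerivRicci cov X Y Z x + covDerivRicci cov Y Z X x + covDerivRicci cov Z X Y x = 0

end Ricci

end

end SymplecticConnection

/-! Fix `p` and work in symmetric normal coordinates on `V ⊆ E`, with Christoffel symbols `Γ` and
symplectic form `β`. Rays through the origin are geodesics, so `Γ_x(x, x) = 0` on `V`
(`NormalNeighborhood.christoffel_self`), and hence `Γ_0 = 0` (`christoffel_zero`). The geodesic
symmetry reads `x ↦ -x`, so type S says exactly that `β` is even
(`NormalNeighborhood.coordFormL_neg`).

The derivative of `β` is then odd. Since `∇ω = 0` expresses this derivative through `Γ`, the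
endomorphism `Γ_x(w) + Γ_{-x}(w)` is skew for `β_x` and so has trace zero: `x ↦ tr Γ_x(w)` is odd
(`traceL_christoffel_neg`). Differentiating `Γ_x(x, x) = 0` turns the Ricci tensor along a ray into
`r_{tX}(X, X) = tr (∂_X Γ)(X) + (2/t) tr Γ(X) + tr Γ(X)²`, everything taken at `tX`
(`ricciOf_radial`). The first two terms are even in `t`. The last has zero derivative at `t = 0`
because `Γ_0 = 0`. The odd part of the left side therefore has zero derivative at `0`, that is,
`(∂_X r)(X, X) = 0` at the origin (`fderiv_ricciOf_radial`). There `∂` is `∇`, again because `Γ_0 =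
0` (`covDerivRicci_eq`).

The curvature endomorphisms of a symplectic connection are skew for the form, so with the first
Bianchi identity `r` is symmetric (`ricciOf_symm`). Polarizing the diagonal identity gives the
cyclic one (`cyclic_sum_eq_zero`). -/

namespace SymplecticConnection

noncomputable section

set_option linter.unusedSectionVars false

/-! ### Vector fields and Christoffel symbols in a local parametrization. -/

section Parametrization

variable {E : Type*} [NormedAddCommGroup E] [NormedSpace ℝ E] [FiniteDimensional ℝ E]
  {M : Type*} [TopologicalSpace M] [ChartedSpace E M] [IsManifold 𝓘(ℝ, E) ∞ M]
  (φ : PartialDiffeomorph 𝓘(ℝ, E) 𝓘(ℝ, E) E M ∞)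

/-- The differential of a local parametrization. -/
def paramDeriv (x : E) : E →L[ℝ] TangentSpace 𝓘(ℝ, E) (φ x) := mfderiv 𝓘(ℝ, E) 𝓘(ℝ, E) φ x

/-- The expression of a vector field on `M` in a local parametrization. -/
def coordField (X : Π y : M, TangentSpace 𝓘(ℝ, E) y) (x : E) : E :=
  mpullback 𝓘(ℝ, E) 𝓘(ℝ, E) φ X x

/-- The vector field on `M` with a given expression in a local parametrization. -/
def fieldOf (a : E → E) (y : M) : TangentSpace 𝓘(ℝ, E) y :=
  mpullback 𝓘(ℝ, E) 𝓘(ℝ, E) φ.symm a y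

variable {φ} {x : E}

theorem contMDiffAt_param (hx : x ∈ φ.source) : ContMDiffAt 𝓘(ℝ, E) 𝓘(ℝ, E) ∞ φ x :=
  φ.contMDiffOn.contMDiffAt (φ.open_source.mem_nhds hx)

theorem contMDiffAt_param_symm (hx : x ∈ φ.source) :
    ContMDiffAt 𝓘(ℝ, E) 𝓘(ℝ, E) ∞ φ.symm (φ x) :=
  φ.symm.contMDiffOn.contMDiffAt (φ.open_target.mem_nhds (φ.map_source hx))

theorem isInvertible_mfderiv_param (hx : x ∈ φ.source) :
    (mfderiv 𝓘(ℝ, E) 𝓘(ℝ, E) φ x).IsInvertible :=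
  ⟨(φ.isLocalDiffeomorphAt _ _ _ hx).mfderivToContinuousLinearEquiv (by simp), rfl⟩

theorem isInvertible_mfderiv_param_symm {y : M} (hy : y ∈ φ.target) :
    (mfderiv 𝓘(ℝ, E) 𝓘(ℝ, E) φ.symm y).IsInvertible :=
  ⟨(φ.symm.isLocalDiffeomorphAt _ _ _ hy).mfderivToContinuousLinearEquiv (by simp), rfl⟩

theorem coordField_apply (X : Π y : M, TangentSpace 𝓘(ℝ, E) y) (x : E) :
  coordField φ X x = (paramDeriv φ x).inverse (X (φ x)) := rfl

theorem paramDeriv_coordField (hx : x ∈ φ.source) (X : Π y : M, TangentSpace 𝓘(ℝ, E) y) :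
    paramDeriv φ x (coordField φ X x) = X (φ x) := by
  rw [coordField_apply]
  exact (isInvertible_mfderiv_param hx).self_apply_inverse _

theorem inverse_paramDeriv (hx : x ∈ φ.source) (u : E) :
    (paramDeriv φ x).inverse (paramDeriv φ x u) = u := 
  (isInvertible_mfderiv_param hx).inverse_apply_self _

theorem mfderiv_param_symm_paramDeriv (hx : x ∈ φ.source) (u : E) :
    mfderiv 𝓘(ℝ, E) 𝓘(ℝ, E) φ.symm (φ x) (paramDeriv φ x u) = u := by
  have h := mfderiv_comp x ((contMDiffAt_param_symm hx).mdifferentiableAt (by simp))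
    ((contMDiffAt_param hx).mdifferentiableAt (by simp))
  have h' : (φ.symm ∘ φ : E → E) =ᶠ[𝓝 x] id := by
    filter_upwards [φ.open_source.mem_nhds hx] with z hz
    exact φ.left_inv hz
  rw [h'.mfderiv_eq, mfderiv_id] at h
  exact congr($h.symm u)

theorem fieldOf_param (hx : x ∈ φ.source) (a : E → E) :
    fieldOf φ a (φ x) = paramDeriv φ x (a x) := by
  have hs : φ.symm (φ x) = x := φ.left_inv hx
  exact (isInvertible_mfderiv_param_symm (φ.map_source hx)).inverse_apply_eq.2
    ((congrArg a hs).trans (mfderiv_param_symm_paramDeriv hx _).symm)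

theorem coordField_fieldOf (hx : x ∈ φ.source) (a : E → E) :
    coordField φ (fieldOf φ a) x = a x := by
  rw [coordField_apply, fieldOf_param hx, inverse_paramDeriv hx]

theorem contDiffAt_coordField {m : ℕ∞ω} (hm : m + 1 ≤ ∞) (hx : x ∈ φ.source)
    {X : Π y : M, TangentSpace 𝓘(ℝ, E) y} (hX : CMDiffAt m (T% X) (φ x)) :
    ContDiffAt ℝ m (coordField φ X) x :=
  have : IsManifold 𝓘(ℝ, E) 1 M := .of_le (n := ∞) (by simp)
  contMDiffAt_vectorSpace_iff_contDiffAt.1 <|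
    hX.mpullback_vectorField_preimage (contMDiffAt_param hx) (isInvertible_mfderiv_param hx) hm

theorem contMDiffAt_fieldOf {m : ℕ∞ω} (hm : m + 1 ≤ ∞) (hx : x ∈ φ.source)
    {a : E → E} (ha : ContDiffAt ℝ m a x) :
    CMDiffAt m (T% (fieldOf φ a)) (φ x) := by
  have : IsManifold 𝓘(ℝ, E) 1 M := .of_le (n := ∞) (by simp)
  refine ContMDiffAt.mpullback_vectorField_preimage (V := a) ?_ (contMDiffAt_param_symm hx)
    (isInvertible_mfderiv_param_symm (φ.map_source hx)) hm
  have : φ.symm (φ x) = x := φ.left_inv hx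
  rw [this]
  exact contMDiffAt_vectorSpace_iff_contDiffAt.2 ha

theorem differentiableAt_coordField (hx : x ∈ φ.source)
    {X : Π y : M, TangentSpace 𝓘(ℝ, E) y} (hX : MDiffAt (T% X) (φ x)) :
    DifferentiableAt ℝ (coordField φ X) x := by
  have : IsManifold 𝓘(ℝ, E) 1 M := .of_le (n := ∞) (by simp)
  have h : MDiffAt (T% (mpullback 𝓘(ℝ, E) 𝓘(ℝ, E) φ X)) x :=
    hX.mpullback_vectorField (contMDiffAt_param hx) (isInvertible_mfderiv_param hx) (n := ∞)
      (ENat.LEInfty.out)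
  have h' := (mdifferentiableAt_section ..).1 h
  simp only [trivializationAt_model_space_apply] at h'
  exact h'.differentiableAt

theorem eventually_param_iff (hx : x ∈ φ.source) {p : M → Prop} :
    (∀ᶠ y in 𝓝 (φ x), p y) ↔ ∀ᶠ z in 𝓝 x, p (φ z) := by
  have h : Filter.map φ (𝓝 x) = 𝓝 (φ x) := φ.toOpenPartialHomeomorph.map_nhds_eq hx
  rw [← h, Filter.eventually_map]

theorem hasMFDerivAt_of_param {F : Type*} [NormedAddCommGroup F] [NormedSpace ℝ F]
    (hx : x ∈ φ.source) {g : M → F} {g' : E → F} (hg' : DifferentiableAt ℝ g' x)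
    (hg : ∀ᶠ z in 𝓝 x, g (φ z) = g' z) :
    HasMFDerivAt 𝓘(ℝ, E) 𝓘(ℝ, F) g (φ x)
      (fderiv ℝ g' x ∘L mfderiv 𝓘(ℝ, E) 𝓘(ℝ, E) φ.symm (φ x)) := by
  have h : g =ᶠ[𝓝 (φ x)] g' ∘ φ.symm := by
    refine (eventually_param_iff hx).2 ?_
    filter_upwards [hg, φ.open_source.mem_nhds hx] with z hz hz'
    have : φ.symm (φ z) = z := φ.left_inv hz'
    rw [hz, Function.comp_apply, this]
  have hs : φ.symm (φ x) = x := φ.left_inv hx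
  have h1 : HasMFDerivAt 𝓘(ℝ, E) 𝓘(ℝ, F) g' (φ.symm (φ x)) (fderiv ℝ g' x) := by
    rw [hs]
    exact hg'.hasFDerivAt.hasMFDerivAt
  exact (h1.comp (φ x)
    ((contMDiffAt_param_symm hx).mdifferentiableAt (by simp)).hasMFDerivAt).congr_of_eventuallyEq h

theorem mdifferentiableAt_of_param {F : Type*} [NormedAddCommGroup F] [NormedSpace ℝ F]
    (hx : x ∈ φ.source) {g : M → F} {g' : E → F} (hg' : DifferentiableAt ℝ g' x)
    (hg : ∀ᶠ z in 𝓝 x, g (φ z) = g' z) :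
    MDifferentiableAt 𝓘(ℝ, E) 𝓘(ℝ, F) g (φ x) :=
  (hasMFDerivAt_of_param hx hg' hg).mdifferentiableAt

theorem mvfderiv_paramDeriv {F : Type*} [NormedAddCommGroup F] [NormedSpace ℝ F]
    (hx : x ∈ φ.source) {g : M → F} {g' : E → F} (hg' : DifferentiableAt ℝ g' x)
    (hg : ∀ᶠ z in 𝓝 x, g (φ z) = g' z) (w : E) :
    mvfderiv 𝓘(ℝ, E) g (φ x) (paramDeriv φ x w) = fderiv ℝ g' x w := by
  rw [mvfderiv, (hasMFDerivAt_of_param hx hg' hg).mfderiv]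
  exact congrArg (fderiv ℝ g' x) (mfderiv_param_symm_paramDeriv hx w)

theorem mdifferentiableAt_fieldOf (hx : x ∈ φ.source) {a : E → E} (ha : ContDiffAt ℝ ∞ a x) :
    MDiffAt (T% (fieldOf φ a)) (φ x) :=
  (contMDiffAt_fieldOf (by simp) hx ha).mdifferentiableAt (by simp)

variable (cov : CovariantDerivative 𝓘(ℝ, E) E (TangentSpace 𝓘(ℝ, E) : M → Type _))

theorem cov_sum {ι : Type*} (s : Finset ι) {σ : ι → Π y : M, TangentSpace 𝓘(ℝ, E) y} {y : M}
    (hσ : ∀ i ∈ s, MDiffAt (T% (σ i)) y) :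
    cov (fun z ↦ ∑ i ∈ s, σ i z) y = ∑ i ∈ s, cov (σ i) y := by
  classical
  induction s using Finset.induction_on with
  | empty => exact congr_fun cov.zero y
  | insert a s ha h =>
    simp only [Finset.mem_insert, forall_eq_or_imp] at hσ
    simp only [Finset.sum_insert ha, ← h hσ.2]
    exact cov.isCovariantDerivativeOn.add hσ.1 (.sum_section hσ.2) (Set.mem_univ y)

variable (φ)

/-- The Christoffel symbols of a connection in a local parametrization: `christoffel cov φ x u w`
is the expression of `∇_w u` for constant fields `u`, `w`. -/
def christoffel (x : E) : E →L[ℝ] E →L[ℝ] E :=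
  ∑ i, ((Module.finBasis ℝ E).coord i).toContinuousLinearMap.smulRight
    ((paramDeriv φ x).inverse ∘L
      cov (fieldOf φ fun _ ↦ Module.finBasis ℝ E i) (φ x) ∘L paramDeriv φ x)

variable {φ}

/-- Near the point, `Y` is the sum of its coordinate functions times the fields that are constant in
the parametrization. The Leibniz rule produces the derivative term, and `christoffel` collects the
rest. -/
theorem cov_paramDeriv (hx : x ∈ φ.source) {Y : Π y : M, TangentSpace 𝓘(ℝ, E) y}
    (hY : MDiffAt (T% Y) (φ x)) (w : E) :
    cov Y (φ x) (paramDeriv φ x w) = paramDeriv φ x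
      (fderiv ℝ (coordField φ Y) x w + christoffel φ cov x (coordField φ Y x) w) := by
  set b := Module.finBasis ℝ E
  have hYd := differentiableAt_coordField hx hY
  set c : Fin (Module.finrank ℝ E) → E →L[ℝ] ℝ := fun i ↦ (b.coord i).toContinuousLinearMap
    with hc
  have hcb (v : E) : ∑ i, c i v • b i = v := b.sum_repr v
  set g : Fin (Module.finrank ℝ E) → M → ℝ := fun i y ↦ c i (coordField φ Y (φ.symm y))
  have hg' (i) : DifferentiableAt ℝ (fun z ↦ c i (coordField φ Y z)) x :=
    (c i).differentiableAt.comp x hYd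
  have hgφ (i) {z : E} (hz : z ∈ φ.source) : g i (φ z) = c i (coordField φ Y z) := by
    have : φ.symm (φ z) = z := φ.left_inv hz
    simp only [g, this]
  have hge (i) : ∀ᶠ z in 𝓝 x, g i (φ z) = c i (coordField φ Y z) := by
    filter_upwards [φ.open_source.mem_nhds hx] with z hz using hgφ i hz
  have hgd (i) : MDiffAt (g i) (φ x) := mdifferentiableAt_of_param hx (hg' i) (hge i)
  have hσ (i) : MDiffAt (T% (fieldOf φ fun _ ↦ b i)) (φ x) :=
    mdifferentiableAt_fieldOf hx contDiffAt_const
  have hgσ (i) : MDiffAt (T% (g i • fieldOf φ fun _ ↦ b i)) (φ x) :=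
    (hgd i).smul_section (hσ i)
  have hYe : ∀ᶠ y in 𝓝 (φ x), Y y = ∑ i, (g i • fieldOf φ fun _ ↦ b i) y := by
    refine (eventually_param_iff hx).2 ?_
    filter_upwards [φ.open_source.mem_nhds hx] with z hz
    simp only [Pi.smul_apply', fieldOf_param hz, hgφ _ hz]
    rw [← paramDeriv_coordField hz Y]
    conv_lhs => rw [← hcb (coordField φ Y z)]
    simp
  have h1 := cov.isCovariantDerivativeOn.congr_of_eventuallyEq hY
    (MDifferentiableAt.sum_section fun i _ ↦ hgσ i) Filter.univ_mem hYe
  rw [h1, cov_sum cov _ fun i _ ↦ hgσ i]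
  have h2 (i) := cov.isCovariantDerivativeOn.leibniz (hσ i) (hgd i) (Set.mem_univ (φ x))
  have h3 (i) : mvfderiv 𝓘(ℝ, E) (g i) (φ x) (paramDeriv φ x w) =
      c i (fderiv ℝ (coordField φ Y) x w) := by
    rw [mvfderiv_paramDeriv hx (hg' i) (hge i)]
    exact congr($(((c i).hasFDerivAt.comp x hYd.hasFDerivAt).fderiv) w)
  have h4 : christoffel φ cov x (coordField φ Y x) w = ∑ i, c i (coordField φ Y x) •
      (paramDeriv φ x).inverse (cov (fieldOf φ fun _ ↦ b i) (φ x) (paramDeriv φ x w)) := by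
    simp [christoffel, c, b]
  have h5 (v : TangentSpace 𝓘(ℝ, E) (φ x)) :
      paramDeriv φ x ((paramDeriv φ x).inverse v) = v :=
    (isInvertible_mfderiv_param hx).self_apply_inverse _
  rw [map_add, h4, ← hcb (fderiv ℝ (coordField φ Y) x w), map_sum, map_sum,
    ← Finset.sum_add_distrib, sum_apply]
  refine Finset.sum_congr rfl fun i _ ↦ ?_
  rw [h2, add_apply, smul_apply,
    ContinuousLinearMap.smulRight_apply, h3, fieldOf_param hx, hgφ i hx, map_smul, map_smul, h5,
    add_comm]

theorem christoffel_apply (hx : x ∈ φ.source) (u w : E) :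
    christoffel φ cov x u w =
      (paramDeriv φ x).inverse (cov (fieldOf φ fun _ ↦ u) (φ x) (paramDeriv φ x w)) := by
  rw [cov_paramDeriv cov hx (mdifferentiableAt_fieldOf hx contDiffAt_const),
    inverse_paramDeriv hx, coordField_fieldOf hx]
  have : coordField φ (fieldOf φ fun _ ↦ u) =ᶠ[𝓝 x] fun _ ↦ u := by
    filter_upwards [φ.open_source.mem_nhds hx] with z hz using coordField_fieldOf hz _
  simp [this.fderiv_eq]

/-- A smooth connection maps a vector field that is smooth near `x` to a section that is smooth
at `x`. -/
theorem contMDiffAt_cov [T2Space M] [hcov : cov.ContMDiffCovariantDerivative ∞]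
    {σ : Π x : M, TangentSpace 𝓘(ℝ, E) x} {x : M}
    (hσ : ∀ᶠ y in 𝓝 x, CMDiffAt ∞ (T% σ) y) :
    ContMDiffAt 𝓘(ℝ, E) (𝓘(ℝ, E).prod 𝓘(ℝ, E →L[ℝ] E)) ∞
      (fun y : M ↦ (⟨y, cov σ y⟩ : TotalSpace (E →L[ℝ] E)
        fun y : M ↦ TangentSpace 𝓘(ℝ, E) y →L[ℝ] TangentSpace 𝓘(ℝ, E) y)) x := by
  obtain ⟨u, hu, huo, hxu⟩ := eventually_nhds_iff.1 hσ
  -- The smoothness class is applied to globally smooth fields, so `σ` is cut off by a bump function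
  -- equal to `1` near `x`. Locality of the connection makes this harmless.
  obtain ⟨f, -, hf⟩ := (SmoothBumpFunction.nhds_basis_tsupport (I := 𝓘(ℝ, E)) x).mem_iff.1
    (huo.mem_nhds hxu)
  have h1 : CMDiff ∞ (T% ((f : M → ℝ) • σ)) :=
    ContMDiffOn.smul_section_of_tsupport f.contMDiff.contMDiffOn huo hf
      fun y hy ↦ (hu y hy).contMDiffWithinAt
  have h2 := (hcov.contMDiff.contMDiff (σ := (f : M → ℝ) • σ) h1.contMDiffOn).contMDiffAt
    Filter.univ_mem (x := x)
  refine h2.congr_of_eventuallyEq ?_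
  have h3 := f.eventuallyEq_one.eventually_nhds
  filter_upwards [h3, huo.mem_nhds hxu] with y hy hyu
  have : cov σ y = cov ((f : M → ℝ) • σ) y := by
    refine cov.isCovariantDerivativeOn.congr_of_eventuallyEq
      ((hu y hyu).mdifferentiableAt (by simp)) (h1.contMDiffAt.mdifferentiableAt (by simp))
      (s := Set.univ) Filter.univ_mem ?_
    filter_upwards [hy] with z hz
    simp [hz]
  rw [this]

theorem eventually_contMDiffAt_fieldOf (hx : x ∈ φ.source) {a : E → E}
    (ha : ∀ᶠ z in 𝓝 x, ContDiffAt ℝ ∞ a z) :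
    ∀ᶠ y in 𝓝 (φ x), CMDiffAt ∞ (T% (fieldOf φ a)) y := by
  refine (eventually_param_iff hx).2 ?_
  filter_upwards [ha, φ.open_source.mem_nhds hx] with z hz hz'
  exact contMDiffAt_fieldOf (by simp) hz' hz

/-- In finite dimension a linear map is a fixed linear combination of its values on a basis. This
reduces smoothness of `Γ`, `β` and the Ricci form to that of scalar or vector functions. -/
theorem contDiffAt_clm {F G H : Type*} [NormedAddCommGroup F] [NormedSpace ℝ F] [NormedAddCommGroup G]
    [NormedSpace ℝ G] [FiniteDimensional ℝ G] [NormedAddCommGroup H] [NormedSpace ℝ H]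
    {n : ℕ∞ω} {f : F → G →L[ℝ] H} {x : F} (h : ∀ v, ContDiffAt ℝ n (fun y ↦ f y v) x) :
    ContDiffAt ℝ n f x := by
  set b := Module.finBasis ℝ G
  have : f = fun y ↦ ∑ i, ((ContinuousLinearMap.smulRightL ℝ G H
      (b.coord i).toContinuousLinearMap) (f y (b i))) := by
    ext y v
    conv_lhs => rw [← b.sum_repr v]
    simp [-Module.Basis.sum_repr]
  rw [this]
  exact ContDiffAt.sum fun i _ ↦ (ContinuousLinearMap.contDiff _).contDiffAt.comp x (h (b i))

theorem contDiffAt_christoffel [T2Space M] [cov.ContMDiffCovariantDerivative ∞]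
    (hx : x ∈ φ.source) : ContDiffAt ℝ ∞ (christoffel φ cov) x := by
  refine contDiffAt_clm fun u ↦ contDiffAt_clm fun w ↦ ?_
  have hc (v : E) : ∀ᶠ z in 𝓝 x, ContDiffAt ℝ ∞ (fun _ : E ↦ v) z := .of_forall fun _ ↦ contDiffAt_const
  have h := (contMDiffAt_cov cov (eventually_contMDiffAt_fieldOf hx (hc u))).clm_bundle_apply
    (contMDiffAt_fieldOf (φ := φ) (a := fun _ ↦ w) (m := ∞) (by simp) hx contDiffAt_const)
  refine (contDiffAt_coordField (by simp) hx h).congr_of_eventuallyEq ?_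
  filter_upwards [φ.open_source.mem_nhds hx] with z hz
  rw [christoffel_apply cov hz, coordField_apply, fieldOf_param hz]

end Parametrization

/-! ### Torsion, forms, derivatives along curves and curvature in coordinates. -/

section LocalFormulas

variable {E : Type*} [NormedAddCommGroup E] [NormedSpace ℝ E] [FiniteDimensional ℝ E]
  {M : Type*} [TopologicalSpace M] [ChartedSpace E M] [IsManifold 𝓘(ℝ, E) ∞ M]
  {φ : PartialDiffeomorph 𝓘(ℝ, E) 𝓘(ℝ, E) E M ∞} {x : E}
  (cov : CovariantDerivative 𝓘(ℝ, E) E (TangentSpace 𝓘(ℝ, E) : M → Type _))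

theorem coordField_mlieBracket (hx : x ∈ φ.source) {X Y : Π y : M, TangentSpace 𝓘(ℝ, E) y}
    (hX : MDiffAt (T% X) (φ x)) (hY : MDiffAt (T% Y) (φ x)) :
    coordField φ (mlieBracket 𝓘(ℝ, E) X Y) x =
      lieBracket ℝ (coordField φ X) (coordField φ Y) x := by
  have : IsManifold 𝓘(ℝ, E) (minSmoothness ℝ 2) M := .of_le (n := ∞) (by simp; exact ENat.LEInfty.out)
  have h := mpullback_mlieBracket (I := 𝓘(ℝ, E)) (I' := 𝓘(ℝ, E)) hX hY (contMDiffAt_param hx)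
    (by simp; exact ENat.LEInfty.out)
  refine h.trans ?_
  rw [← mlieBracketWithin_univ, mlieBracketWithin_eq_lieBracketWithin]
  exact congr_fun (lieBracketWithin_univ (V := coordField φ X) (W := coordField φ Y)) x

theorem coordField_fieldOf_eventuallyEq (hx : x ∈ φ.source) (a : E → E) :
    coordField φ (fieldOf φ a) =ᶠ[𝓝 x] a := by
  filter_upwards [φ.open_source.mem_nhds hx] with z hz using coordField_fieldOf hz _

/-- Constant fields commute, so vanishing torsion gives `∇_w u = ∇_u w` for them. -/
theorem christoffel_symm (htor : cov.torsion = 0) (hx : x ∈ φ.source) (u w : E) :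
    christoffel φ cov x u w = christoffel φ cov x w u := by
  have hd (v : E) : MDiffAt (T% (fieldOf φ fun _ ↦ v)) (φ x) :=
    mdifferentiableAt_fieldOf hx contDiffAt_const
  have h := CovariantDerivative.torsion_eq_zero_iff cov |>.1 htor (hd w) (hd u)
  have hb := coordField_mlieBracket hx (hd w) (hd u)
  rw [coordField_apply, ← h, (coordField_fieldOf_eventuallyEq hx _).lieBracket_vectorField_eq
    (coordField_fieldOf_eventuallyEq hx _)] at hb
  rw [christoffel_apply cov hx, christoffel_apply cov hx, ← sub_eq_zero, ← map_sub]
  rw [fieldOf_param hx, fieldOf_param hx] at hb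
  rw [hb]
  simp [lieBracket]

/-- A constant field in a local parametrization agrees near a given point with a smooth field on
the whole manifold. -/
theorem exists_contMDiff_eq_fieldOf [T2Space M] (hx : x ∈ φ.source) (u : E) :
    ∃ X : Π y : M, TangentSpace 𝓘(ℝ, E) y, CMDiff ∞ (T% X) ∧
      ∀ᶠ y in 𝓝 (φ x), X y = fieldOf φ (fun _ ↦ u) y := by
  obtain ⟨f, -, hf⟩ := (SmoothBumpFunction.nhds_basis_tsupport (I := 𝓘(ℝ, E)) (φ x)).mem_iff.1
    (φ.open_target.mem_nhds (φ.map_source hx))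
  refine ⟨(f : M → ℝ) • fieldOf φ (fun _ ↦ u), ?_, ?_⟩
  · refine ContMDiffOn.smul_section_of_tsupport f.contMDiff.contMDiffOn φ.open_target hf
      fun y hy ↦ ?_
    obtain ⟨z, hz, rfl⟩ : ∃ z ∈ φ.source, φ z = y := ⟨_, φ.map_target hy, φ.right_inv hy⟩
    exact (contMDiffAt_fieldOf (by simp) hz contDiffAt_const).contMDiffWithinAt
  · filter_upwards [f.eventuallyEq_one] with y hy
    simp [hy]

/-- The expression of a 2-form in a local parametrization. -/
def coordForm (φ : PartialDiffeomorph 𝓘(ℝ, E) 𝓘(ℝ, E) E M ∞)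
    (Ω : Π x : M, TangentSpace 𝓘(ℝ, E) x →L[ℝ] TangentSpace 𝓘(ℝ, E) x →L[ℝ] ℝ)
    (x u v : E) : ℝ := Ω (φ x) (paramDeriv φ x u) (paramDeriv φ x v)

variable {Ω : Π x : M, TangentSpace 𝓘(ℝ, E) x →L[ℝ] TangentSpace 𝓘(ℝ, E) x →L[ℝ] ℝ}

theorem contDiffAt_coordForm (hΩ : IsSymplecticForm Ω) (hx : x ∈ φ.source) (u v : E) :
    ContDiffAt ℝ ∞ (fun z ↦ coordForm φ Ω z u v) x := by
  have hc (v : E) := contMDiffAt_fieldOf (φ := φ) (a := fun _ ↦ v) (m := ∞) (by simp) hx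
    contDiffAt_const
  have h : ContMDiffAt 𝓘(ℝ, E) (𝓘(ℝ, E).prod 𝓘(ℝ)) ∞
      (fun m ↦ TotalSpace.mk' ℝ (E := Bundle.Trivial M ℝ) m
        (Ω m (fieldOf φ (fun _ ↦ u) m) (fieldOf φ (fun _ ↦ v) m))) (φ x) :=
    ContMDiffAt.clm_bundle_apply₂ (F₁ := E) (F₂ := E) hΩ.smooth.contMDiffAt (hc u) (hc v)
  simp only [contMDiffAt_totalSpace] at h
  have h2 := contMDiffAt_iff_contDiffAt.1 (h.2.comp x (contMDiffAt_param hx))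
  refine h2.congr_of_eventuallyEq ?_
  filter_upwards [φ.open_source.mem_nhds hx] with z hz
  simp [coordForm, fieldOf_param hz]

theorem differentiableAt_coordForm (hΩ : IsSymplecticForm Ω) (hx : x ∈ φ.source) (u v : E) :
    DifferentiableAt ℝ (fun z ↦ coordForm φ Ω z u v) x :=
  (contDiffAt_coordForm hΩ hx u v).differentiableAt (by simp)

/-- This is `∇ω = 0` evaluated on constant fields. Since `parallel` speaks of global smooth fields,
the constant fields are replaced by global ones with the same germs at the point. -/
theorem fderiv_coordForm [T2Space M] (hΩ : IsSymplecticForm Ω)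
    (hcov : IsSymplecticConnection Ω cov) (hx : x ∈ φ.source) (u v w : E) :
    fderiv ℝ (fun z ↦ coordForm φ Ω z u v) x w =
      coordForm φ Ω x (christoffel φ cov x u w) v + coordForm φ Ω x u (christoffel φ cov x v w) := by
  obtain ⟨X, hX, hXe⟩ := exists_contMDiff_eq_fieldOf (φ := φ) hx w
  obtain ⟨Y, hY, hYe⟩ := exists_contMDiff_eq_fieldOf (φ := φ) hx u
  obtain ⟨Z, hZ, hZe⟩ := exists_contMDiff_eq_fieldOf (φ := φ) hx v
  have h := hcov.parallel X Y Z hX hY hZ (φ x)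
  have hcong {Y : Π y : M, TangentSpace 𝓘(ℝ, E) y} {u : E} (hY : CMDiff ∞ (T% Y))
      (hYe : ∀ᶠ y in 𝓝 (φ x), Y y = fieldOf φ (fun _ ↦ u) y) :
      cov Y (φ x) = cov (fieldOf φ (fun _ ↦ u)) (φ x) :=
    cov.isCovariantDerivativeOn.congr_of_eventuallyEq (hY.contMDiffAt.mdifferentiableAt (by simp))
      (mdifferentiableAt_fieldOf hx contDiffAt_const) Filter.univ_mem hYe
  have hinv (v : TangentSpace 𝓘(ℝ, E) (φ x)) :
      paramDeriv φ x ((paramDeriv φ x).inverse v) = v :=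
    (isInvertible_mfderiv_param hx).self_apply_inverse _
  rw [hcong hY hYe, hcong hZ hZe, hXe.self_of_nhds, hYe.self_of_nhds, hZe.self_of_nhds,
    fieldOf_param hx, fieldOf_param hx, fieldOf_param hx,
    mvfderiv_paramDeriv hx (differentiableAt_coordForm hΩ hx u v)] at h
  · rw [coordForm, coordForm, christoffel_apply cov hx, christoffel_apply cov hx, hinv, hinv]
    linarith
  · filter_upwards [(eventually_param_iff hx).1 hYe, (eventually_param_iff hx).1 hZe,
      φ.open_source.mem_nhds hx] with z h1 h2 hz
    rw [h1, h2, fieldOf_param hz, fieldOf_param hz, coordForm]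

theorem velocity_eq {γ : ℝ → M} {c : ℝ → E} {t : ℝ} {c' : E} (hc : HasDerivAt c c' t)
    (hx : c t ∈ φ.source) (hγ : ∀ᶠ s in 𝓝 t, γ s = φ (c s)) :
    (velocity (E := E) γ t : E) = paramDeriv φ (c t) c' := by
  have h1 : HasMFDerivAt 𝓘(ℝ, ℝ) 𝓘(ℝ, E) γ t
      (mfderiv 𝓘(ℝ, E) 𝓘(ℝ, E) φ (c t) ∘L ContinuousLinearMap.toSpanSingleton ℝ c') :=
    (((contMDiffAt_param hx).mdifferentiableAt (by simp)).hasMFDerivAt.comp t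
      hc.hasFDerivAt.hasMFDerivAt).congr_of_eventuallyEq hγ
  have h2 : (mfderiv 𝓘(ℝ, ℝ) 𝓘(ℝ, E) γ t : ℝ →L[ℝ] E) (1 : ℝ) =
      (mfderiv 𝓘(ℝ, E) 𝓘(ℝ, E) φ (c t) : E →L[ℝ] E) (ContinuousLinearMap.toSpanSingleton ℝ c' 1) :=
    congr(($(h1.mfderiv) : ℝ →L[ℝ] E) (1 : ℝ))
  rw [ContinuousLinearMap.toSpanSingleton_apply, one_smul] at h2
  exact h2

/-- Every tangent space is definitionally `E`, so vectors over two base points are compared in `E`.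
With the base points as free variables the equality can be substituted. -/
theorem totalSpace_mk_eq {q q' : M} (h : q = q') {v : TangentSpace 𝓘(ℝ, E) q}
    {w : TangentSpace 𝓘(ℝ, E) q'} (hvw : (v : E) = w) :
    (⟨q, v⟩ : TangentBundle 𝓘(ℝ, E) M) = ⟨q', w⟩ := by
  subst h
  subst hvw
  rfl

theorem differentiableAt_trivialization (q : M) (hx : x ∈ φ.source)
    (hq : φ x ∈ (trivializationAt E (TangentSpace 𝓘(ℝ, E) : M → Type _) q).baseSet) :
    DifferentiableAt ℝ (fun z ↦
      ((trivializationAt E (TangentSpace 𝓘(ℝ, E) : M → Type _) q).continuousLinearMapAt ℝ (φ z) ∘L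
        paramDeriv φ z : E →L[ℝ] E)) x := by
  set e := trivializationAt E (TangentSpace 𝓘(ℝ, E) : M → Type _) q
  refine (contDiffAt_clm (n := ∞) fun v ↦ ?_).differentiableAt (by simp)
  have h := contMDiffAt_fieldOf (φ := φ) (a := fun _ ↦ v) (m := ∞) (by simp) hx contDiffAt_const
  have h' := (e.contMDiffAt_iff (IB := 𝓘(ℝ, E)) (e.mem_source.2 hq)).1 h
  refine (contMDiffAt_iff_contDiffAt.1 (h'.2.comp x (contMDiffAt_param hx))).congr_of_eventuallyEq ?_
  have hc : ContinuousAt φ x := (contMDiffAt_param hx).continuousAt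
  filter_upwards [φ.open_source.mem_nhds hx, hc.preimage_mem_nhds (e.open_baseSet.mem_nhds hq)]
    with z hz hz'
  simp only [ContinuousLinearMap.comp_apply, Function.comp_apply]
  rw [e.continuousLinearMapAt_apply_of_mem ℝ hz', fieldOf_param hz]

/-- The frozen extension `W = extend E v` has constant components in the trivialization. Hence the
components of the field along the curve are a constant plus `T (a - W)`, where `T` is the
trivialization read in the parametrization. As `a - W` vanishes at time `t`, the derivative of `T`
does not contribute, and the derivative of `W` cancels against the one in `∇W`. The base point `q`
and the vectors are variables so that they can be substituted. -/
theorem covDerivAlong_eq_aux {c a : ℝ → E} {t : ℝ} {c' a' : E} (hc : HasDerivAt c c' t)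
    (ha : HasDerivAt a a' t) (hx : c t ∈ φ.source) {q : M} (hq : q = φ (c t))
    {v w : TangentSpace 𝓘(ℝ, E) q} (hv : (v : E) = paramDeriv φ (c t) (a t))
    (hw : (w : E) = paramDeriv φ (c t) c') {f : ℝ → E}
    (hf : ∀ᶠ s in 𝓝 t, f s = (trivializationAt E (TangentSpace 𝓘(ℝ, E) : M → Type _) q
      ⟨φ (c s), paramDeriv φ (c s) (a s)⟩).2) :
    ((trivializationAt E (TangentSpace 𝓘(ℝ, E) : M → Type _) q).symm q (deriv f t)
      + cov (extend E v) q w : E) =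
        paramDeriv φ (c t) (a' + christoffel φ cov (c t) (a t) c') := by
  subst hq
  subst hv
  subst hw
  set e := trivializationAt E (TangentSpace 𝓘(ℝ, E) : M → Type _) (φ (c t)) with he
  set W : Π y : M, TangentSpace 𝓘(ℝ, E) y := extend E (paramDeriv φ (c t) (a t)) with hW
  have hmem : φ (c t) ∈ e.baseSet := FiberBundle.mem_baseSet_trivializationAt' _
  have hWd : MDiffAt (T% W) (φ (c t)) := mdifferentiableAt_extend ..
  have hWc : coordField φ W (c t) = a t := by
    rw [coordField_apply, hW, extend_apply_self, inverse_paramDeriv hx]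
  have hWd' := (differentiableAt_coordField hx hWd).hasFDerivAt
  set T : E → E →L[ℝ] E := fun z ↦ e.continuousLinearMapAt ℝ (φ z) ∘L paramDeriv φ z
  have hT : DifferentiableAt ℝ T (c t) := differentiableAt_trivialization _ hx hmem
  have hcont : ContinuousAt (fun s ↦ φ (c s)) t :=
    ContinuousAt.comp (g := φ) (contMDiffAt_param hx).continuousAt hc.continuousAt
  have hf' : f =ᶠ[𝓝 t] fun s ↦ T (c s) (a s - coordField φ W (c s)) +
      (e ⟨φ (c t), paramDeriv φ (c t) (a t)⟩).2 := by
    filter_upwards [hf, hcont.preimage_mem_nhds (e.open_baseSet.mem_nhds hmem),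
      hc.continuousAt.preimage_mem_nhds (φ.open_source.mem_nhds hx)] with s hs hs' hs''
    have h1 : T (c s) (a s) = f s := by
      rw [hs]
      exact e.continuousLinearMapAt_apply_of_mem ℝ hs' _
    have h2 : T (c s) (coordField φ W (c s)) = (e ⟨φ (c t), paramDeriv φ (c t) (a t)⟩).2 := by
      have : e.continuousLinearMapAt ℝ (φ (c s)) (W (φ (c s))) =
          (e ⟨φ (c t), paramDeriv φ (c t) (a t)⟩).2 := by
        rw [e.continuousLinearMapAt_apply_of_mem ℝ hs']
        have := congrArg Prod.snd
          (e.apply_mk_symm hs' (e ⟨φ (c t), paramDeriv φ (c t) (a t)⟩).2)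
        exact this
      rw [← this, ← paramDeriv_coordField hs'' W]
      rfl
    rw [map_sub, h1, h2]
    abel
  have hder := (((hT.hasFDerivAt.comp_hasDerivAt t hc).clm_apply
    (ha.sub (hWd'.comp_hasDerivAt t hc))).add_const
      ((e ⟨φ (c t), paramDeriv φ (c t) (a t)⟩).2))
  have hder' := (hder.congr_of_eventuallyEq hf').deriv
  rw [hder', cov_paramDeriv cov hx hWd, hWc]
  simp only [Function.comp_apply, hWc, Pi.sub_apply, sub_self, map_zero, zero_add]
  have h3 (u : E) : e.symm (φ (c t)) (T (c t) u) = paramDeriv φ (c t) u := by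
    have : T (c t) u = (e ⟨φ (c t), paramDeriv φ (c t) u⟩).2 :=
      e.continuousLinearMapAt_apply_of_mem ℝ hmem _
    rw [this, e.symm_apply_apply_mk hmem]
  rw [h3, ← map_add]
  congr 1
  abel

theorem covDerivAlong_eq {γ : ℝ → M} {V : Π t : ℝ, TangentSpace 𝓘(ℝ, E) (γ t)} {c a : ℝ → E}
    {t : ℝ} {c' a' : E} (hc : HasDerivAt c c' t) (ha : HasDerivAt a a' t) (hx : c t ∈ φ.source)
    (hγ : ∀ᶠ s in 𝓝 t, γ s = φ (c s)) (hV : ∀ᶠ s in 𝓝 t, (V s : E) = paramDeriv φ (c s) (a s)) :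
    (covDerivAlong cov γ V t : E) =
      paramDeriv φ (c t) (a' + christoffel φ cov (c t) (a t) c') := by
  refine covDerivAlong_eq_aux cov hc ha hx hγ.self_of_nhds hV.self_of_nhds
    (velocity_eq hc hx hγ) ?_
  filter_upwards [hγ, hV] with s h1 h2
  rw [totalSpace_mk_eq h1 h2]

/-- The expression of `v ↦ R(u, v)w` in terms of Christoffel symbols. -/
def curvatureOf (Γ : E → E →L[ℝ] E →L[ℝ] E) (x u w : E) : E →L[ℝ] E :=
  fderiv ℝ Γ x u w - ((fderiv ℝ Γ x).flip w).flip u + (Γ x).flip u ∘L Γ x w - Γ x (Γ x w u)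

theorem curvatureOf_apply (Γ : E → E →L[ℝ] E →L[ℝ] E) (x u w v : E) :
    curvatureOf Γ x u w v =
      fderiv ℝ Γ x u w v - fderiv ℝ Γ x v w u + Γ x (Γ x w v) u - Γ x (Γ x w u) v := by
  simp [curvatureOf]

theorem coordField_cov (hx : x ∈ φ.source) {Y Z : Π y : M, TangentSpace 𝓘(ℝ, E) y}
    (hZ : MDiffAt (T% Z) (φ x)) :
    coordField φ (fun y ↦ cov Z y (Y y)) x = fderiv ℝ (coordField φ Z) x (coordField φ Y x) +
      christoffel φ cov x (coordField φ Z x) (coordField φ Y x) := by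
  rw [coordField_apply, ← paramDeriv_coordField hx Y, cov_paramDeriv cov hx hZ,
    inverse_paramDeriv hx]

theorem coordField_curvature [T2Space M] [cov.ContMDiffCovariantDerivative ∞] (hx : x ∈ φ.source)
    {X Y Z : Π y : M, TangentSpace 𝓘(ℝ, E) y}
    (hX : MDiffAt (T% X) (φ x)) (hY : MDiffAt (T% Y) (φ x))
    (hZ : ∀ᶠ y in 𝓝 (φ x), CMDiffAt ∞ (T% Z) y) :
    coordField φ (curvature cov X Y Z) x = curvatureOf (christoffel φ cov) x
      (coordField φ X x) (coordField φ Z x) (coordField φ Y x) := by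
  have hZ' : ∀ᶠ z in 𝓝 x, z ∈ φ.source ∧ MDiffAt (T% Z) (φ z) := by
    filter_upwards [(eventually_param_iff hx).1 hZ, φ.open_source.mem_nhds hx] with z hz hz'
    exact ⟨hz', hz.mdifferentiableAt (by simp)⟩
  have hZd : ContDiffAt ℝ ∞ (coordField φ Z) x :=
    contDiffAt_coordField (by simp) hx hZ.self_of_nhds
  have hXd := (differentiableAt_coordField hx hX).hasFDerivAt
  have hYd := (differentiableAt_coordField hx hY).hasFDerivAt
  have hZd1 := (hZd.differentiableAt (by simp)).hasFDerivAt
  have hZd2 := ((hZd.fderiv_right (m := ∞) (by simp)).differentiableAt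
    (by simp)).hasFDerivAt
  have hΓ := ((contDiffAt_christoffel cov hx).differentiableAt (by simp)).hasFDerivAt
  have key {X Y : Π y : M, TangentSpace 𝓘(ℝ, E) y} (hY : MDiffAt (T% Y) (φ x)) :
      coordField φ (fun y ↦ cov (fun y ↦ cov Z y (Y y)) y (X y)) x =
        fderiv ℝ (fun z ↦ fderiv ℝ (coordField φ Z) z (coordField φ Y z) +
          christoffel φ cov z (coordField φ Z z) (coordField φ Y z)) x (coordField φ X x) +
        christoffel φ cov x (fderiv ℝ (coordField φ Z) x (coordField φ Y x) +
          christoffel φ cov x (coordField φ Z x) (coordField φ Y x)) (coordField φ X x) := by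
    have hd : MDiffAt (T% (fun y ↦ cov Z y (Y y))) (φ x) :=
      (mdifferentiableAt_cov cov hZ).clm_bundle_apply hY
    rw [coordField_cov cov hx hd, coordField_cov cov hx hZ'.self_of_nhds.2]
    congr 2
    refine Filter.EventuallyEq.fderiv_eq ?_
    filter_upwards [hZ'] with z hz using coordField_cov cov hz.1 hz.2
  have e : coordField φ (curvature cov X Y Z) x =
      coordField φ (fun y ↦ cov (fun y ↦ cov Z y (Y y)) y (X y)) x -
      coordField φ (fun y ↦ cov (fun y ↦ cov Z y (X y)) y (Y y)) x -
      coordField φ (fun y ↦ cov Z y (mlieBracket 𝓘(ℝ, E) X Y y)) x := by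
    simp only [coordField_apply, curvature, map_sub]
  have hd {Y : Π y : M, TangentSpace 𝓘(ℝ, E) y} (hYd : HasFDerivAt (coordField φ Y)
      (fderiv ℝ (coordField φ Y) x) x) (w : E) :
      fderiv ℝ (fun z ↦ fderiv ℝ (coordField φ Z) z (coordField φ Y z) +
        christoffel φ cov z (coordField φ Z z) (coordField φ Y z)) x w =
      fderiv ℝ (coordField φ Z) x (fderiv ℝ (coordField φ Y) x w) +
      fderiv ℝ (fderiv ℝ (coordField φ Z)) x w (coordField φ Y x) +
      (christoffel φ cov x (coordField φ Z x) (fderiv ℝ (coordField φ Y) x w) +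
        (christoffel φ cov x (fderiv ℝ (coordField φ Z) x w) (coordField φ Y x) +
          fderiv ℝ (christoffel φ cov) x w (coordField φ Z x) (coordField φ Y x))) :=
    congr($(((hZd2.clm_apply hYd).add ((hΓ.clm_apply hZd1).clm_apply hYd)).fderiv) w)
  -- Second derivatives of `Z` cancel by symmetry, and derivatives of `X` and `Y` cancel against the
  -- Lie bracket.
  have hsymm := (hZd.isSymmSndFDerivAt (by simp; exact ENat.LEInfty.out)).eq
    (coordField φ X x) (coordField φ Y x)
  rw [e, key hY, key hX, coordField_cov cov hx hZ'.self_of_nhds.2, coordField_mlieBracket hx hX hY,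
    curvatureOf_apply, hd hYd, hd hXd, hsymm, lieBracket]
  simp only [map_sub, map_add, add_apply]
  abel

/-- Tensoriality allows the middle field to be the constant one. The coordinate formula depends on
the other two fields only through their values at the point, so their extensions do not matter. -/
theorem paramDeriv_curvatureEndo [T2Space M] [cov.ContMDiffCovariantDerivative ∞]
    (hx : x ∈ φ.source) (u w v : E) :
    curvatureEndo cov (φ x) (paramDeriv φ x u) (paramDeriv φ x w) (paramDeriv φ x v) =
      paramDeriv φ x (curvatureOf (christoffel φ cov) x u w v) := by
  have hv : MDiffAt (T% (fieldOf φ fun _ ↦ v)) (φ x) :=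
    mdifferentiableAt_fieldOf hx contDiffAt_const
  have hext (v : E) : coordField φ (extend E (paramDeriv φ x v)) x = v := by
    rw [coordField_apply, extend_apply_self, inverse_paramDeriv hx]
  have hw := eventually_contMDiffAt_extend (paramDeriv φ x w)
  have h1 := TensorialAt.mkHom_apply (curvature_tensorialAt cov
    (X := extend E (paramDeriv φ x u)) hw) hv
  rw [fieldOf_param hx] at h1
  rw [curvatureEndo, h1]
  have h2 := coordField_curvature cov hx (X := extend E (paramDeriv φ x u))
    (mdifferentiableAt_extend ..) hv hw
  rw [hext, hext, coordField_fieldOf hx] at h2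
  rw [← h2, paramDeriv_coordField hx]

theorem ricci_paramDeriv [T2Space M] [cov.ContMDiffCovariantDerivative ∞]
    (hx : x ∈ φ.source) (u w : E) :
    ricci cov (φ x) (paramDeriv φ x u) (paramDeriv φ x w) =
      LinearMap.trace ℝ E (curvatureOf (christoffel φ cov) x u w).toLinearMap := by
  obtain ⟨e', he⟩ := isInvertible_mfderiv_param hx
  let e : E ≃L[ℝ] TangentSpace 𝓘(ℝ, E) (φ x) := e'
  have he' (v : E) : e v = paramDeriv φ x v := congr($he v)
  rw [ricci, ← LinearMap.trace_conj' (curvatureOf (christoffel φ cov) x u w).toLinearMap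
    e.toLinearEquiv]
  congr 1
  ext v
  have h := paramDeriv_curvatureEndo cov hx u w (e.symm v)
  have hv : paramDeriv φ x (e.symm v) = v := (he' _).symm.trans (e.apply_symm_apply v)
  rw [hv] at h
  exact h.trans (he' _).symm

end LocalFormulas

/-! ### Uniqueness of geodesics, the exponential map and normal coordinates. -/

section Geodesics

variable {E : Type*} [NormedAddCommGroup E] [NormedSpace ℝ E] [FiniteDimensional ℝ E]
  {M : Type*} [TopologicalSpace M] [ChartedSpace E M] [IsManifold 𝓘(ℝ, E) ∞ M]
  {φ : PartialDiffeomorph 𝓘(ℝ, E) 𝓘(ℝ, E) E M ∞} {x : E}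
  (cov : CovariantDerivative 𝓘(ℝ, E) E (TangentSpace 𝓘(ℝ, E) : M → Type _))

/-- The local parametrization of `M` given by the preferred chart at `p`. -/
def chartParam (p : M) : PartialDiffeomorph 𝓘(ℝ, E) 𝓘(ℝ, E) E M ∞ where
  toPartialEquiv := (chartAt E p).symm.toPartialEquiv
  open_source := (chartAt E p).open_target
  open_target := (chartAt E p).open_source
  contMDiffOn_toFun := contMDiffOn_chart_symm
  contMDiffOn_invFun := contMDiffOn_chart

theorem mem_chartParam_target (p : M) : p ∈ (chartParam (E := E) p).target :=
  mem_chart_source E p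

theorem contDiffAt_deriv {F : Type*} [NormedAddCommGroup F] [NormedSpace ℝ F] {c : ℝ → F} {t : ℝ}
    (hc : ContDiffAt ℝ ∞ c t) : ContDiffAt ℝ ∞ (deriv c) t :=
  (hc.fderiv_right (m := ∞) (by simp)).clm_apply (contDiffAt_const (c := (1 : ℝ)))

/-- A geodesic read in a local parametrization solves the geodesic equation. -/
theorem IsGeodesicOn.coord {γ : ℝ → M} {J : Set ℝ} (hJ : IsOpen J) (hγ : IsGeodesicOn cov γ J)
    {t : ℝ} (ht : t ∈ J) (hq : γ t ∈ φ.target) :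
    ContDiffAt ℝ ∞ (fun s ↦ φ.symm (γ s)) t ∧
      φ.symm (γ t) ∈ φ.source ∧ φ (φ.symm (γ t)) = γ t ∧
      (velocity (E := E) γ t : E) =
        paramDeriv φ (φ.symm (γ t)) (deriv (fun s ↦ φ.symm (γ s)) t) ∧
      deriv (deriv fun s ↦ φ.symm (γ s)) t = - christoffel φ cov (φ.symm (γ t))
        (deriv (fun s ↦ φ.symm (γ s)) t) (deriv (fun s ↦ φ.symm (γ s)) t) := by
  set c : ℝ → E := fun s ↦ φ.symm (γ s)
  have hcont : ∀ {s}, s ∈ J → ContMDiffAt 𝓘(ℝ, ℝ) 𝓘(ℝ, E) ∞ γ s := fun hs ↦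
    hγ.1.contMDiffAt (hJ.mem_nhds hs)
  have hnear : ∀ᶠ s in 𝓝 t, s ∈ J ∧ γ s ∈ φ.target :=
    Filter.Eventually.and (hJ.mem_nhds ht) ((hcont ht).continuousAt.preimage_mem_nhds (φ.open_target.mem_nhds hq))
  have hc : ∀ᶠ s in 𝓝 t, ContDiffAt ℝ ∞ c s ∧ c s ∈ φ.source ∧ γ s = φ (c s) := by
    filter_upwards [hnear] with s hs
    refine ⟨?_, φ.map_target hs.2, (φ.right_inv hs.2).symm⟩
    exact ((φ.symm.contMDiffOn.contMDiffAt (φ.open_target.mem_nhds hs.2)).comp s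
      (hcont hs.1)).contDiffAt
  obtain ⟨h1, h2, h3⟩ := hc.self_of_nhds
  have hd : ∀ᶠ s in 𝓝 t, HasDerivAt c (deriv c s) s := by
    filter_upwards [hc] with s hs using (hs.1.differentiableAt (by simp)).hasDerivAt
  have hv : ∀ᶠ s in 𝓝 t, (velocity (E := E) γ s : E) = paramDeriv φ (c s) (deriv c s) := by
    filter_upwards [hc.eventually_nhds, hd] with s hs hs'
    exact velocity_eq hs' hs.self_of_nhds.2.1 (hs.mono fun _ h ↦ h.2.2)
  refine ⟨h1, h2, h3.symm, hv.self_of_nhds, ?_⟩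
  have hdd : HasDerivAt (deriv c) (deriv (deriv c) t) t :=
    ((contDiffAt_deriv h1).differentiableAt (by simp)).hasDerivAt
  have h4 := covDerivAlong_eq cov hd.self_of_nhds hdd h2 (hc.mono fun _ h ↦ h.2.2) hv
  rw [hγ.2 t ht] at h4
  have h5 := congrArg (paramDeriv φ (c t)).inverse h4
  rw [inverse_paramDeriv h2] at h5
  have h6 : (paramDeriv φ (c t)).inverse (0 : TangentSpace 𝓘(ℝ, E) (φ (c t))) = 0 := map_zero _
  exact eq_neg_of_add_eq_zero_left (h5.symm.trans h6)

/-- The equation is a first-order system for `(c, c')` on `E × E` with a `C¹`, hence locally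
Lipschitz, right-hand side. -/
theorem eventuallyEq_of_second_order_ode {Γ : E → E →L[ℝ] E →L[ℝ] E} {c₁ c₂ : ℝ → E} {t : ℝ}
    (hΓ : ContDiffAt ℝ 1 Γ (c₁ t))
    (h₁ : ∀ᶠ s in 𝓝 t, ContDiffAt ℝ ∞ c₁ s ∧
      deriv (deriv c₁) s = - Γ (c₁ s) (deriv c₁ s) (deriv c₁ s))
    (h₂ : ∀ᶠ s in 𝓝 t, ContDiffAt ℝ ∞ c₂ s ∧
      deriv (deriv c₂) s = - Γ (c₂ s) (deriv c₂ s) (deriv c₂ s))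
    (h : c₁ t = c₂ t) (h' : deriv c₁ t = deriv c₂ t) : c₁ =ᶠ[𝓝 t] c₂ := by
  set v : E × E → E × E := fun z ↦ (z.2, - Γ z.1 z.2 z.2)
  have hv : ContDiffAt ℝ 1 v (c₁ t, deriv c₁ t) := by
    have h1 : ContDiffAt ℝ 1 (fun z : E × E ↦ Γ z.1) (c₁ t, deriv c₁ t) :=
      ContDiffAt.comp (g := Γ) (c₁ t, deriv c₁ t) hΓ contDiffAt_fst
    exact contDiffAt_snd.prodMk ((h1.clm_apply contDiffAt_snd).clm_apply contDiffAt_snd).neg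
  obtain ⟨K, s, hs, hK⟩ := hv.exists_lipschitzOnWith
  have key {c : ℝ → E} (hc : ∀ᶠ s in 𝓝 t, ContDiffAt ℝ ∞ c s ∧
      deriv (deriv c) s = - Γ (c s) (deriv c s) (deriv c s)) (h : c₁ t = c t)
      (h' : deriv c₁ t = deriv c t) :
      ∀ᶠ τ in 𝓝 t, HasDerivAt (fun τ ↦ (c τ, deriv c τ)) (v (c τ, deriv c τ)) τ ∧
        (c τ, deriv c τ) ∈ s := by
    have hd : ∀ᶠ τ in 𝓝 t, HasDerivAt (fun τ ↦ (c τ, deriv c τ)) (v (c τ, deriv c τ)) τ := by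
      filter_upwards [hc] with τ hτ
      have hdd : HasDerivAt (deriv c) (deriv (deriv c) τ) τ :=
        ((contDiffAt_deriv hτ.1).differentiableAt (by simp)).hasDerivAt
      rw [hτ.2] at hdd
      exact (hτ.1.differentiableAt (by simp)).hasDerivAt.prodMk hdd
    refine hd.and (hd.self_of_nhds.continuousAt.preimage_mem_nhds ?_)
    rwa [← h, ← h']
  have := ODE_solution_unique_of_eventually (v := fun _ ↦ v) (s := fun _ ↦ s) (K := K)
    (.of_forall fun _ ↦ hK) (key h₁ rfl rfl) (key h₂ h h') (by simp [h, h'])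
  exact this.mono fun τ hτ ↦ congrArg Prod.fst hτ

theorem mem_nhds_param_symm {γ : ℝ → M} {J : Set ℝ} (hJ : IsOpen J) (hγ : IsGeodesicOn cov γ J)
    {t : ℝ} (ht : t ∈ J) (hq : γ t ∈ φ.target) : ∀ᶠ s in 𝓝 t, s ∈ J ∧ γ s ∈ φ.target :=
  Filter.Eventually.and (hJ.mem_nhds ht)
    ((hγ.1.contMDiffAt (hJ.mem_nhds ht)).continuousAt.preimage_mem_nhds (φ.open_target.mem_nhds hq))

/-- Two geodesics with the same position and velocity at some time agree near this time. -/
theorem IsGeodesicOn.eventuallyEq [T2Space M] [cov.ContMDiffCovariantDerivative ∞] {γ₁ γ₂ : ℝ → M}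
    {J : Set ℝ} (hJ : IsOpen J) (h₁ : IsGeodesicOn cov γ₁ J) (h₂ : IsGeodesicOn cov γ₂ J)
    {t : ℝ} (ht : t ∈ J) (hq₁ : γ₁ t ∈ φ.target) (hq₂ : γ₂ t ∈ φ.target)
    (h : φ.symm (γ₁ t) = φ.symm (γ₂ t))
    (h' : deriv (fun s ↦ φ.symm (γ₁ s)) t = deriv (fun s ↦ φ.symm (γ₂ s)) t) :
    γ₁ =ᶠ[𝓝 t] γ₂ := by
  have hn₁ := mem_nhds_param_symm cov hJ h₁ ht hq₁
  have hn₂ := mem_nhds_param_symm cov hJ h₂ ht hq₂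
  have hΓ := (contDiffAt_christoffel cov (h₁.coord cov hJ ht hq₁).2.1).of_le
    (show (1 : ℕ∞ω) ≤ ∞ by simp)
  have := eventuallyEq_of_second_order_ode hΓ
    (hn₁.mono fun s hs ↦ ⟨(h₁.coord cov hJ hs.1 hs.2).1, (h₁.coord cov hJ hs.1 hs.2).2.2.2.2⟩)
    (hn₂.mono fun s hs ↦ ⟨(h₂.coord cov hJ hs.1 hs.2).1, (h₂.coord cov hJ hs.1 hs.2).2.2.2.2⟩)
    h h'
  filter_upwards [this, hn₁, hn₂] with s hs hs₁ hs₂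
  exact φ.symm.injOn hs₁.2 hs₂.2 hs

theorem paramDeriv_injective (hx : x ∈ φ.source) : Function.Injective (paramDeriv φ x) :=
  Function.LeftInverse.injective (inverse_paramDeriv hx)

/-- Uniqueness of geodesics. -/
theorem IsGeodesicOn.eqOn [T2Space M] [cov.ContMDiffCovariantDerivative ∞] {γ₁ γ₂ : ℝ → M}
    {J : Set ℝ} (hJ : IsOpen J) (hJ' : IsPreconnected J) (h₁ : IsGeodesicOn cov γ₁ J)
    (h₂ : IsGeodesicOn cov γ₂ J) {t₀ : ℝ} (ht₀ : t₀ ∈ J) (h : γ₁ t₀ = γ₂ t₀)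
    (h' : (velocity (E := E) γ₁ t₀ : E) = velocity (E := E) γ₂ t₀) : Set.EqOn γ₁ γ₂ J := by
  have hcont {γ : ℝ → M} (hγ : IsGeodesicOn cov γ J) {t} (ht : t ∈ J) : ContinuousAt γ t :=
    (hγ.1.contMDiffAt (hJ.mem_nhds ht)).continuousAt
  set S : Set ℝ := {t | γ₁ =ᶠ[𝓝 t] γ₂} with hS
  suffices J ⊆ S from fun t ht ↦ (this ht).self_of_nhds
  -- Connectedness argument: `S`, the set of times near which the geodesics agree, is open. At a
  -- limit point of `S` position and velocity agree by continuity, so uniqueness for the equation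
  -- applies there too.
  refine hJ'.subset_of_closure_inter_subset ?_ ⟨t₀, ht₀, ?_⟩ ?_
  · exact isOpen_iff_mem_nhds.2 fun t ht ↦ ht.eventually_nhds
  · set φ := chartParam (E := E) (γ₁ t₀)
    have hq₁ : γ₁ t₀ ∈ φ.target := mem_chartParam_target _
    have hq₂ : γ₂ t₀ ∈ φ.target := h ▸ hq₁
    have c₁ := h₁.coord cov hJ ht₀ hq₁
    have c₂ := h₂.coord cov hJ ht₀ hq₂
    refine h₁.eventuallyEq cov hJ h₂ ht₀ hq₁ hq₂ (by rw [h]) ?_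
    rw [← h] at c₂
    exact paramDeriv_injective c₁.2.1 (c₁.2.2.2.1.symm.trans (h'.trans c₂.2.2.2.1))
  · rintro t ⟨htS, ht⟩
    have hfreq : ∃ᶠ s in 𝓝 t, s ∈ S := mem_closure_iff_frequently.1 htS
    have heq : γ₁ t = γ₂ t := tendsto_nhds_unique_of_frequently_eq (hcont h₁ ht) (hcont h₂ ht)
      (hfreq.mono fun s hs ↦ hs.self_of_nhds)
    set φ := chartParam (E := E) (γ₁ t)
    have hq₁ : γ₁ t ∈ φ.target := mem_chartParam_target _
    have hq₂ : γ₂ t ∈ φ.target := heq ▸ hq₁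
    have c₁ := h₁.coord cov hJ ht hq₁
    have c₂ := h₂.coord cov hJ ht hq₂
    refine h₁.eventuallyEq cov hJ h₂ ht hq₁ hq₂ (by rw [heq]) ?_
    refine tendsto_nhds_unique_of_frequently_eq (contDiffAt_deriv c₁.1).continuousAt
      (contDiffAt_deriv c₂.1).continuousAt (hfreq.mono fun s hs ↦ Filter.EventuallyEq.deriv_eq ?_)
    filter_upwards [hs] with τ hτ
    rw [hτ]

/-- A reparametrization of a geodesic by a linear map is a geodesic. -/
theorem IsGeodesicOn.comp_mul {γ : ℝ → M} {J J' : Set ℝ} (hJ : IsOpen J)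
    (hγ : IsGeodesicOn cov γ J) {r : ℝ} (hr : ∀ t ∈ J', r * t ∈ J) :
    IsGeodesicOn cov (fun t ↦ γ (r * t)) J' ∧
      ∀ t ∈ J', (velocity (E := E) (fun t ↦ γ (r * t)) t : E) =
        r • (velocity (E := E) γ (r * t) : E) := by
  have key {t : ℝ} (ht : t ∈ J') : ∃ (φ : PartialDiffeomorph 𝓘(ℝ, E) 𝓘(ℝ, E) E M ∞) (c : ℝ → E),
      (∀ᶠ s in 𝓝 t, γ (r * s) = φ (c (r * s)) ∧ c (r * s) ∈ φ.source ∧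
        HasDerivAt c (deriv c (r * s)) (r * s)) ∧
      HasDerivAt (deriv c) (- christoffel φ cov (c (r * t)) (deriv c (r * t)) (deriv c (r * t)))
        (r * t) ∧
      (velocity (E := E) γ (r * t) : E) = paramDeriv φ (c (r * t)) (deriv c (r * t)) := by
    set φ := chartParam (E := E) (γ (r * t))
    have hq : γ (r * t) ∈ φ.target := mem_chartParam_target _
    have hc := hγ.coord cov hJ (hr t ht) hq
    refine ⟨φ, fun s ↦ φ.symm (γ s), ?_, ?_, hc.2.2.2.1⟩
    · have hcont : Filter.Tendsto (fun s ↦ r * s) (𝓝 t) (𝓝 (r * t)) :=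
        (continuous_const.mul continuous_id).tendsto t
      filter_upwards [hcont.eventually (mem_nhds_param_symm cov hJ hγ (hr t ht) hq)] with s hs
      have := hγ.coord cov hJ hs.1 hs.2
      exact ⟨this.2.2.1.symm, this.2.1, (this.1.differentiableAt (by simp)).hasDerivAt⟩
    · rw [← hc.2.2.2.2]
      exact ((contDiffAt_deriv hc.1).differentiableAt (by simp)).hasDerivAt
  have hmul (s : ℝ) : HasDerivAt (fun s ↦ r * s) r s := by
    simpa using (hasDerivAt_id s).const_mul r
  refine ⟨⟨?_, fun t ht ↦ ?_⟩, fun t ht ↦ ?_⟩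
  · exact hγ.1.comp (contMDiff_iff_contDiff.2 (contDiff_const.mul contDiff_id)).contMDiffOn hr
  · obtain ⟨φ, c, h1, h2, -⟩ := key ht
    have hd : ∀ᶠ s in 𝓝 t, HasDerivAt (fun s ↦ c (r * s)) (r • deriv c (r * s)) s :=
      h1.mono fun s hs ↦ hs.2.2.scomp s (hmul s)
    have h3 := covDerivAlong_eq cov (γ := fun t ↦ γ (r * t)) hd.self_of_nhds
      ((h2.scomp t (hmul t)).const_smul r) h1.self_of_nhds.2.1 (h1.mono fun s hs ↦ hs.1)
      (V := velocity (fun t ↦ γ (r * t))) (by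
        filter_upwards [h1.eventually_nhds, hd] with s hs hs'
        exact velocity_eq hs' hs.self_of_nhds.2.1 (hs.mono fun _ h ↦ h.1))
    refine h3.trans ?_
    -- The geodesic equation is homogeneous of degree two: acceleration and Christoffel term both
    -- acquire the factor `r²`.
    have : r • r • - christoffel φ cov (c (r * t)) (deriv c (r * t)) (deriv c (r * t)) +
        christoffel φ cov (c (r * t)) (r • deriv c (r * t)) (r • deriv c (r * t)) = 0 := by
      simp
    exact (congrArg (paramDeriv φ (c (r * t))) this).trans (map_zero _)
  · obtain ⟨φ, c, h1, h2, h3⟩ := key ht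
    have hd : HasDerivAt (fun s ↦ c (r * s)) (r • deriv c (r * t)) t :=
      h1.self_of_nhds.2.2.scomp t (hmul t)
    refine (velocity_eq hd h1.self_of_nhds.2.1 (h1.mono fun s hs ↦ hs.1)).trans ?_
    rw [h3, map_smul]
    rfl

theorem fst_snd_of_totalSpace_eq {q q' : M} {v : TangentSpace 𝓘(ℝ, E) q}
    {w : TangentSpace 𝓘(ℝ, E) q'} (h : (⟨q, v⟩ : TangentBundle 𝓘(ℝ, E) M) = ⟨q', w⟩) :
    q = q' ∧ (v : E) = w := by
  cases h
  exact ⟨rfl, rfl⟩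

theorem IsUnitGeodesic.eqOn [T2Space M] [cov.ContMDiffCovariantDerivative ∞] {p : M}
    {v : TangentSpace 𝓘(ℝ, E) p} {γ₁ γ₂ : ℝ → M} (h₁ : IsUnitGeodesic cov p v γ₁)
    (h₂ : IsUnitGeodesic cov p v γ₂) : Set.EqOn γ₁ γ₂ (Set.Icc 0 1) := by
  obtain ⟨⟨ε₁, hε₁, g₁⟩, e₁⟩ := h₁
  obtain ⟨⟨ε₂, hε₂, g₂⟩, e₂⟩ := h₂
  obtain ⟨e, e'⟩ := fst_snd_of_totalSpace_eq (e₁.trans e₂.symm)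
  set ε := min ε₁ ε₂
  have hε : 0 < ε := lt_min hε₁ hε₂
  have hs {ε'} (h : ε ≤ ε') : Set.Ioo (-ε) (1 + ε) ⊆ Set.Ioo (-ε') (1 + ε') :=
    Set.Ioo_subset_Ioo (by linarith) (by linarith)
  have hm {γ : ℝ → M} {J J' : Set ℝ} (h : J ⊆ J') (hγ : IsGeodesicOn cov γ J') :
    IsGeodesicOn cov γ J := ⟨hγ.1.mono h, fun t ht ↦ hγ.2 t (h ht)⟩
  refine Set.EqOn.mono (s₂ := Set.Ioo (-ε) (1 + ε))
    (fun t ht ↦ ⟨by linarith [ht.1], by linarith [ht.2]⟩) ?_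
  exact (hm (hs (min_le_left _ _)) g₁).eqOn cov isOpen_Ioo isPreconnected_Ioo
    (hm (hs (min_le_right _ _)) g₂) (t₀ := 0) ⟨by linarith, by linarith⟩ e e'

/-- Uniqueness makes the geodesic picked by `choose` irrelevant. -/
theorem expMap_eq [T2Space M] [cov.ContMDiffCovariantDerivative ∞] {p : M}
    {v : TangentSpace 𝓘(ℝ, E) p} {γ : ℝ → M} (h : IsUnitGeodesic cov p v γ) :
    expMap cov p v = γ 1 := by
  have hex : ∃ γ : ℝ → M, IsUnitGeodesic cov p v γ := ⟨γ, h⟩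
  rw [expMap, dif_pos hex]
  exact IsUnitGeodesic.eqOn cov hex.choose_spec h ⟨by simp, le_rfl⟩

theorem IsUnitGeodesic.comp_mul {p : M} {v : TangentSpace 𝓘(ℝ, E) p} {γ : ℝ → M}
    (h : IsUnitGeodesic cov p v γ) {r : ℝ} (hr : r ∈ Set.Icc (0 : ℝ) 1) :
    IsUnitGeodesic cov p (r • v) (fun t ↦ γ (r * t)) := by
  obtain ⟨⟨ε, hε, g⟩, e⟩ := h
  obtain ⟨e₁, e₂⟩ := fst_snd_of_totalSpace_eq e
  have hJ : ∀ t ∈ Set.Ioo (-ε) (1 + ε), r * t ∈ Set.Ioo (-ε) (1 + ε) := fun t ht ↦ by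
    obtain ⟨h0, h1⟩ := hr
    obtain ⟨h2, h3⟩ := ht
    rcases le_total 0 t with ht | ht
    · have := mul_le_of_le_one_left ht h1
      have := mul_nonneg h0 ht
      constructor <;> linarith
    · have := mul_nonpos_of_nonneg_of_nonpos h0 ht
      constructor <;> nlinarith
  have h' := g.comp_mul cov isOpen_Ioo hJ
  refine ⟨⟨ε, hε, h'.1⟩, totalSpace_mk_eq (by simp [e₁]) ?_⟩
  refine (h'.2 0 ⟨by linarith, by linarith⟩).trans ?_
  rw [mul_zero]
  exact congrArg (r • · : E → E) e₂

/-- The exponential map sends rays to geodesics. -/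
theorem expMap_smul [T2Space M] [cov.ContMDiffCovariantDerivative ∞] {p : M}
    {v : TangentSpace 𝓘(ℝ, E) p} {γ : ℝ → M} (h : IsUnitGeodesic cov p v γ) {r : ℝ}
    (hr : r ∈ Set.Icc (0 : ℝ) 1) : expMap cov p (r • v) = γ r := by
  rw [expMap_eq cov (h.comp_mul cov hr), mul_one]

namespace NormalNeighborhood

variable [T2Space M] [cov.ContMDiffCovariantDerivative ∞] {cov} {p : M}
  (N : NormalNeighborhood cov p)

theorem diffeo_smul {v : E} (hv : v ∈ N.diffeo.source) {γ : ℝ → M}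
    (h : IsUnitGeodesic cov p (show TangentSpace 𝓘(ℝ, E) p from v) γ) {r : ℝ}
    (hr : r ∈ Set.Icc (0 : ℝ) 1) : N.diffeo (r • v) = γ r := by
  refine (N.eq_expMap _ ?_).trans (expMap_smul cov h hr)
  exact N.starConvex.smul_mem hv hr.1 hr.2

theorem diffeo_zero : N.diffeo (0 : E) = p := by
  obtain ⟨γ, h⟩ := N.subset_expDomain 0 N.zero_mem
  have h0 := N.diffeo_smul N.zero_mem h (r := 0) ⟨le_rfl, by simp⟩
  rw [zero_smul] at h0
  exact h0.trans (fst_snd_of_totalSpace_eq h.2).1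

/-- The Christoffel symbols in normal coordinates satisfy `Γ_x(x, x) = 0`. -/
theorem christoffel_self {v : E} (hv : v ∈ N.diffeo.source) :
    christoffel N.diffeo cov v v v = 0 := by
  have hc : ContinuousAt (fun r : ℝ ↦ r • v) 1 := by fun_prop
  have hnear : ∀ᶠ r : ℝ in 𝓝 1, r • v ∈ N.diffeo.source :=
    hc.preimage_mem_nhds (N.diffeo.open_source.mem_nhds (by simpa using hv))
  -- By openness `v` can be lengthened to `w = r • v` with `r > 1` inside the neighborhood. Then `v
  -- = t • w` with `t = r⁻¹` interior to `[0, 1]`, so the ray and the geodesic agree on a full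
  -- neighborhood of `t` and can be differentiated there.
  obtain ⟨r, hr, hr1⟩ := ((hnear.filter_mono nhdsWithin_le_nhds).and
    (self_mem_nhdsWithin (s := Set.Ioi 1))).exists
  have hr0 : 0 < r := zero_lt_one.trans hr1
  obtain ⟨γ, h⟩ := N.subset_expDomain _ hr
  set w : E := r • v
  set t : ℝ := r⁻¹
  have htw : t • w = v := by simp [t, w, hr0.ne']
  have ht : t ∈ Set.Ioo (0 : ℝ) 1 := ⟨inv_pos.2 hr0, inv_lt_one_of_one_lt₀ hr1⟩
  have hγ : ∀ᶠ s in 𝓝 t, γ s = N.diffeo (s • w) := by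
    filter_upwards [isOpen_Ioo.mem_nhds ht] with s hs
    exact (N.diffeo_smul hr h ⟨hs.1.le, hs.2.le⟩).symm
  have hd (s : ℝ) : HasDerivAt (fun s : ℝ ↦ s • w) w s := by
    simpa using (hasDerivAt_id s).smul_const w
  have hsrc : ∀ᶠ s : ℝ in 𝓝 t, s • w ∈ N.diffeo.source :=
    (hd t).continuousAt.preimage_mem_nhds (N.diffeo.open_source.mem_nhds (htw ▸ hv))
  have h1 := covDerivAlong_eq cov (V := velocity γ) (hd t) (hasDerivAt_const t w)
    hsrc.self_of_nhds hγ (by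
      filter_upwards [hsrc, hγ.eventually_nhds] with s h1 h2 using velocity_eq (hd s) h1 h2)
  obtain ⟨⟨ε, hε, g⟩, -⟩ := h
  have h2 := g.2 t ⟨by linarith [ht.1], by linarith [ht.2]⟩
  rw [h2, zero_add, htw] at h1
  have h3 := paramDeriv_injective hv (h1.symm.trans (map_zero (paramDeriv N.diffeo v)).symm)
  simpa [w, hr0.ne'] using h3

end NormalNeighborhood

end Geodesics

/-! ### Trace of skew endomorphisms and symmetry of the Ricci form, in a vector space. -/

section Flat

variable {E : Type*} [NormedAddCommGroup E] [NormedSpace ℝ E] [FiniteDimensional ℝ E]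

/-- Structures on the space of bilinear maps, in which `Γ` and `β` take their values. -/
instance instNormedAddCommGroupBilin {F : Type*} [NormedAddCommGroup F] [NormedSpace ℝ F] :
    NormedAddCommGroup (E →L[ℝ] E →L[ℝ] F) := ContinuousLinearMap.toNormedAddCommGroup

instance instNormedSpaceBilin {F : Type*} [NormedAddCommGroup F] [NormedSpace ℝ F] :
    NormedSpace ℝ (E →L[ℝ] E →L[ℝ] F) := ContinuousLinearMap.toNormedSpace

instance instAddCommGroupBilin {F : Type*} [NormedAddCommGroup F] [NormedSpace ℝ F] :
    AddCommGroup (E →L[ℝ] E →L[ℝ] F) := NormedAddCommGroup.toAddCommGroup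

instance instAddCommMonoidBilin {F : Type*} [NormedAddCommGroup F] [NormedSpace ℝ F] :
    AddCommMonoid (E →L[ℝ] E →L[ℝ] F) := ContinuousLinearMap.addCommMonoid

instance instAddMonoidBilin {F : Type*} [NormedAddCommGroup F] [NormedSpace ℝ F] :
    AddMonoid (E →L[ℝ] E →L[ℝ] F) := AddCommMonoid.toAddMonoid

instance instAddZeroClassBilin {F : Type*} [NormedAddCommGroup F] [NormedSpace ℝ F] :
    AddZeroClass (E →L[ℝ] E →L[ℝ] F) := AddMonoid.toAddZeroClass

/-- The trace as a continuous linear form. -/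
def traceL (E : Type*) [NormedAddCommGroup E] [NormedSpace ℝ E] [FiniteDimensional ℝ E] :
    (E →L[ℝ] E) →L[ℝ] ℝ :=
  (LinearMap.trace ℝ E ∘ₗ ContinuousLinearMap.coeLM ℝ).toContinuousLinearMap

theorem traceL_apply (A : E →L[ℝ] E) : traceL E A = LinearMap.trace ℝ E A.toLinearMap := rfl

theorem traceL_comp_comm (A B : E →L[ℝ] E) : traceL E (A ∘L B) = traceL E (B ∘L A) :=
  LinearMap.trace_mul_comm ℝ A.toLinearMap B.toLinearMap

/-- An infinitesimal isometry of a nondegenerate bilinear form has trace zero. -/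
theorem traceL_eq_zero_of_skew {B : E →L[ℝ] E →L[ℝ] ℝ} (hB : ∀ u, (∀ v, B u v = 0) → u = 0)
    {A : E →L[ℝ] E} (hA : ∀ u v, B (A u) v + B u (A v) = 0) : traceL E A = 0 := by
  let Φ : E →ₗ[ℝ] Module.Dual ℝ E := ContinuousLinearMap.coeLM ℝ ∘ₗ B.toLinearMap
  have hΦ (u v : E) : Φ u v = B u v := rfl
  have hinj : Function.Injective Φ := (injective_iff_map_eq_zero Φ).2 fun u hu ↦
    hB u fun v ↦ congr($hu v)
  let e : E ≃ₗ[ℝ] Module.Dual ℝ E :=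
    Φ.linearEquivOfInjective hinj (Subspace.dual_finrank_eq).symm
  have he (u v : E) : e u v = B u v := rfl
  -- Through the isomorphism `E ≃ E*` given by `B`, skewness says that `A` is conjugate to the
  -- transpose of `-A`, so `tr A = -tr A`.
  have h : e.conj A.toLinearMap = Module.Dual.transpose (R := ℝ) (-A.toLinearMap) := by
    ext f v
    obtain ⟨u, rfl⟩ := e.surjective f
    have := hA u v
    rw [LinearEquiv.conj_apply_apply, e.symm_apply_apply, he]
    change B (A u) v = B u (-(A v))
    rw [map_neg]
    linarith
  have h2 := LinearMap.trace_conj' A.toLinearMap e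
  rw [h, LinearMap.trace_transpose', map_neg] at h2
  rw [traceL_apply]
  linarith

variable {V : Set E} {Γ : E → E →L[ℝ] E →L[ℝ] E} {β : E → E →L[ℝ] E →L[ℝ] ℝ}

theorem curvatureOf_add_left (x u u' w : E) :
    curvatureOf Γ x (u + u') w = curvatureOf Γ x u w + curvatureOf Γ x u' w := by
  ext v
  simp only [curvatureOf_apply, map_add, add_apply]
  abel

theorem curvatureOf_add_right (x u w w' : E) :
    curvatureOf Γ x u (w + w') = curvatureOf Γ x u w + curvatureOf Γ x u w' := by
  ext v
  simp only [curvatureOf_apply, map_add, add_apply]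
  abel

theorem curvatureOf_smul_left (x : E) (c : ℝ) (u w : E) :
    curvatureOf Γ x (c • u) w = c • curvatureOf Γ x u w := by
  ext v
  simp only [curvatureOf_apply, map_smul, smul_apply, smul_sub, smul_add]

theorem curvatureOf_smul_right (x : E) (c : ℝ) (u w : E) :
    curvatureOf Γ x u (c • w) = c • curvatureOf Γ x u w := by
  ext v
  simp only [curvatureOf_apply, map_smul, smul_apply, smul_sub, smul_add]

/-- The Ricci form in terms of Christoffel symbols. -/
def ricciOf (Γ : E → E →L[ℝ] E →L[ℝ] E) (x : E) : E →L[ℝ] E →L[ℝ] ℝ :=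
  (LinearMap.mk₂ ℝ (fun u w ↦ traceL E (curvatureOf Γ x u w))
    (fun u u' w ↦ by rw [curvatureOf_add_left, map_add])
    (fun c u w ↦ by rw [curvatureOf_smul_left, map_smul])
    (fun u w w' ↦ by rw [curvatureOf_add_right, map_add])
    (fun c u w ↦ by rw [curvatureOf_smul_right, map_smul])).toContinuousBilinearMap

theorem ricciOf_apply (x u w : E) : ricciOf Γ x u w = traceL E (curvatureOf Γ x u w) := rfl

theorem contDiffAt_curvatureOf {x : E} (hΓ : ContDiffAt ℝ ∞ Γ x) (u w : E) :
    ContDiffAt ℝ ∞ (fun x ↦ curvatureOf Γ x u w) x := by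
  refine contDiffAt_clm fun v ↦ ?_
  simp only [curvatureOf_apply]
  have h := hΓ.fderiv_right (m := ∞) (by simp)
  have hc (a : E) : ContDiffAt ℝ ∞ (fun _ : E ↦ a) x := contDiffAt_const
  exact ((((h.clm_apply (hc _)).clm_apply (hc _)).clm_apply (hc _)).sub
    (((h.clm_apply (hc _)).clm_apply (hc _)).clm_apply (hc _))).add
    ((hΓ.clm_apply ((hΓ.clm_apply (hc _)).clm_apply (hc _))).clm_apply (hc _)) |>.sub
    ((hΓ.clm_apply ((hΓ.clm_apply (hc _)).clm_apply (hc _))).clm_apply (hc _))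

theorem contDiffAt_ricciOf {x : E} (hΓ : ContDiffAt ℝ ∞ Γ x) : ContDiffAt ℝ ∞ (ricciOf Γ) x :=
  contDiffAt_clm fun u ↦ contDiffAt_clm fun w ↦
    (traceL E).contDiff.contDiffAt.comp x (contDiffAt_curvatureOf hΓ u w)

/-- Derivative identities below come from restricting to a line, computing the one-variable
derivative in two ways and using its uniqueness. -/
theorem hasDerivAt_comp_line {F : Type*} [NormedAddCommGroup F] [NormedSpace ℝ F] {f : E → F}
    {x : E} (hf : DifferentiableAt ℝ f x) (w : E) :
    HasDerivAt (fun t : ℝ ↦ f (x + t • w)) (fderiv ℝ f x w) 0 := by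
  have h : HasDerivAt (fun t : ℝ ↦ x + t • w) w 0 := by
    simpa using ((hasDerivAt_id (0 : ℝ)).smul_const w).const_add x
  have hf' : HasFDerivAt f (fderiv ℝ f x) (x + (0 : ℝ) • w) := by
    simpa using hf.hasFDerivAt
  exact hf'.comp_hasDerivAt 0 h

theorem eventually_line {p : E → Prop} {x : E} (h : ∀ᶠ y in 𝓝 x, p y) (w : E) :
    ∀ᶠ t : ℝ in 𝓝 0, p (x + t • w) := by
  have hc : ContinuousAt (fun t : ℝ ↦ x + t • w) 0 := by fun_prop
  have := hc.tendsto
  simp only [zero_smul, add_zero] at this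
  exact this.eventually h

theorem fderiv_apply_symm (hV : IsOpen V) (hΓ : ∀ x ∈ V, ContDiffAt ℝ ∞ Γ x)
    (hsymm : ∀ x ∈ V, ∀ u w, Γ x u w = Γ x w u) {x : E} (hx : x ∈ V) (z u w : E) :
    fderiv ℝ Γ x z u w = fderiv ℝ Γ x z w u := by
  have hd := hasDerivAt_comp_line ((hΓ x hx).differentiableAt (by simp)) z
  have h (u w : E) : HasDerivAt (fun t : ℝ ↦ Γ (x + t • z) u w) (fderiv ℝ Γ x z u w) 0 := by
    simpa only [map_zero, zero_apply, add_zero, zero_add] using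
      (hd.clm_apply (hasDerivAt_const 0 u)).clm_apply (hasDerivAt_const 0 w)
  have h' : (fun t : ℝ ↦ Γ (x + t • z) u w) =ᶠ[𝓝 0] fun t ↦ Γ (x + t • z) w u := by
    filter_upwards [eventually_line (hV.mem_nhds hx) z] with t ht using hsymm _ ht u w
  exact ((h u w).congr_of_eventuallyEq h'.symm).unique (h w u)

/-- The Ricci tensor of a connection preserving a nondegenerate form is symmetric. -/
theorem ricciOf_symm (hV : IsOpen V) (hΓ : ∀ x ∈ V, ContDiffAt ℝ ∞ Γ x)
    (hsymm : ∀ x ∈ V, ∀ u w, Γ x u w = Γ x w u) (hβ : ∀ x ∈ V, ContDiffAt ℝ ∞ β x)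
    (hnd : ∀ x ∈ V, ∀ u, (∀ v, β x u v = 0) → u = 0)
    (hpar : ∀ x ∈ V, ∀ w u v, fderiv ℝ β x w u v = β x (Γ x w u) v + β x u (Γ x w v))
    {x : E} (hx : x ∈ V) (u w : E) : ricciOf Γ x u w = ricciOf Γ x w u := by
  have hssymm := (hβ x hx).isSymmSndFDerivAt (by simp; exact ENat.LEInfty.out)
  -- Differentiate `∇β = 0` once more. The second derivative of `β` is symmetric in `u, w`, and so
  -- are the mixed terms `β(Γa, Γb)` together.
  have hsnd (u w a b : E) : fderiv ℝ (fderiv ℝ β) x u w a b =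
      β x (fderiv ℝ Γ x u w a) b + β x (Γ x u (Γ x w a)) b + β x (Γ x w a) (Γ x u b) +
      (β x a (fderiv ℝ Γ x u w b) + β x (Γ x u a) (Γ x w b) + β x a (Γ x u (Γ x w b))) := by
    have hc (a : E) := hasDerivAt_const (𝕜 := ℝ) 0 a
    have hd := hasDerivAt_comp_line ((hΓ x hx).differentiableAt (by simp)) u
    have hβd := hasDerivAt_comp_line ((hβ x hx).differentiableAt (by simp)) u
    have h1 := (((hasDerivAt_comp_line (((hβ x hx).fderiv_right (m := ∞)
      (by simp)).differentiableAt (by simp)) u).clm_apply (hc w)).clm_apply (hc a)).clm_apply (hc b)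
    have hΓ' (a : E) := (hd.clm_apply (hc w)).clm_apply (hc a)
    have h2 := ((hβd.clm_apply (hΓ' a)).clm_apply (hc b)).add
      ((hβd.clm_apply (hc a)).clm_apply (hΓ' b))
    have h3 : (fun t : ℝ ↦ fderiv ℝ β (x + t • u) w a b) =ᶠ[𝓝 0]
        fun t ↦ β (x + t • u) (Γ (x + t • u) w a) b + β (x + t • u) a (Γ (x + t • u) w b) := by
      filter_upwards [eventually_line (hV.mem_nhds hx) u] with t ht using hpar _ ht w a b
    have h4 := h1.unique (h2.congr_of_eventuallyEq h3)
    simp only [map_zero, add_zero, zero_smul, add_apply, hpar x hx] at h4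
    rw [h4]
    ring
  -- The endomorphism is the curvature `R(u, w)`. What survives antisymmetrization of `hsnd` says
  -- that it is skew for `β x`.
  have htr : traceL E ((Γ x u ∘L Γ x w + fderiv ℝ Γ x u w) -
      (Γ x w ∘L Γ x u + fderiv ℝ Γ x w u)) = 0 := by
    refine traceL_eq_zero_of_skew (hnd x hx) fun a b ↦ ?_
    have h := congr($(hssymm.eq u w) a b)
    rw [hsnd, hsnd] at h
    have e (B : E →L[ℝ] E →L[ℝ] ℝ) (p q r s b : E) :
        B (p + q - (r + s)) b = B p b + B q b - (B r b + B s b) := by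
      rw [B.map_sub, B.map_add, B.map_add]; rfl
    have e' (B : E →L[ℝ] ℝ) (p q r s : E) :
        B (p + q - (r + s)) = B p + B q - (B r + B s) := by
      rw [B.map_sub, B.map_add, B.map_add]
    refine (congrArg₂ (· + ·) (e (β x) _ _ _ _ b) (e' (β x a) _ _ _ _)).trans ?_
    change β x (Γ x u (Γ x w a)) b + β x (fderiv ℝ Γ x u w a) b -
      (β x (Γ x w (Γ x u a)) b + β x (fderiv ℝ Γ x w u a) b) +
      (β x a (Γ x u (Γ x w b)) + β x a (fderiv ℝ Γ x u w b) -
      (β x a (Γ x w (Γ x u b)) + β x a (fderiv ℝ Γ x w u b))) = 0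
    linarith
  -- With `Γ` symmetric, `r(u, w) - r(w, u)` becomes the trace of `R(u, w)`, which is the traced
  -- first Bianchi identity.
  have hcurv (u w : E) : curvatureOf Γ x u w = fderiv ℝ Γ x u w -
      ((fderiv ℝ Γ x).flip w).flip u + Γ x u ∘L Γ x w - Γ x (Γ x w u) := by
    ext v
    simp [curvatureOf_apply, hsymm x hx _ u]
  have hflip : ((fderiv ℝ Γ x).flip w).flip u = ((fderiv ℝ Γ x).flip u).flip w := by
    ext v
    simpa using fderiv_apply_symm hV hΓ hsymm hx v w u
  rw [ricciOf_apply, ricciOf_apply, hcurv, hcurv, hflip, hsymm x hx w u]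
  have := traceL_comp_comm (Γ x u) (Γ x w)
  simp only [map_sub, map_add] at htr ⊢
  linarith

end Flat

/-! ### Consequences of `Γ_x(x, x) = 0` and of an even form. -/

section FlatSymmetry

variable {E : Type*} [NormedAddCommGroup E] [NormedSpace ℝ E] [FiniteDimensional ℝ E]
  {V : Set E} {Γ : E → E →L[ℝ] E →L[ℝ] E} {β : E → E →L[ℝ] E →L[ℝ] ℝ}

theorem fderiv_comp_neg_apply {F : Type*} [NormedAddCommGroup F] [NormedSpace ℝ F] {f : E → F}
    {x : E} (hf : DifferentiableAt ℝ f (-x)) (w : E) :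
    fderiv ℝ (fun y ↦ f (-y)) x w = -fderiv ℝ f (-x) w := by
  have h := hf.hasFDerivAt.comp x (hasFDerivAt_id x).neg
  refine congr($(h.fderiv) w).trans ?_
  simp

/-- The divergence form of the Christoffel symbols is odd if the form is even. -/
theorem traceL_christoffel_neg (hV : IsOpen V) (hneg : ∀ x ∈ V, -x ∈ V)
    (hβ : ∀ x ∈ V, ContDiffAt ℝ ∞ β x) (hnd : ∀ x ∈ V, ∀ u, (∀ v, β x u v = 0) → u = 0)
    (hpar : ∀ x ∈ V, ∀ w u v, fderiv ℝ β x w u v = β x (Γ x w u) v + β x u (Γ x w v))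
    (heven : ∀ x ∈ V, β (-x) = β x) {x : E} (hx : x ∈ V) (w : E) :
    traceL E (Γ (-x) w) = -traceL E (Γ x w) := by
  have h1 : fderiv ℝ β x w = -fderiv ℝ β (-x) w := by
    rw [← fderiv_comp_neg_apply ((hβ _ (hneg x hx)).differentiableAt (by simp))]
    refine congr($(Filter.EventuallyEq.fderiv_eq ?_) w)
    filter_upwards [hV.mem_nhds hx] with y hy using (heven y hy).symm
  -- Both endomorphisms are measured by the same form, since `β (-x) = β x`. The two derivatives of
  -- `β` are opposite, so their sum is skew.
  have h2 : traceL E (Γ x w + Γ (-x) w) = 0 := by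
    refine traceL_eq_zero_of_skew (hnd x hx) fun u v ↦ ?_
    have h3 := hpar x hx w u v
    have h4 := hpar (-x) (hneg x hx) w u v
    rw [heven x hx] at h4
    have h5 : fderiv ℝ β x w u v = -fderiv ℝ β (-x) w u v := congr($h1 u v)
    rw [add_apply, add_apply, map_add, map_add, add_apply]
    linarith
  rw [map_add] at h2
  linarith

/-- In normal coordinates the Christoffel symbols vanish at the origin. -/
theorem christoffel_zero (hV : IsOpen V) (h0 : (0 : E) ∈ V)
    (hΓ : ∀ x ∈ V, ContDiffAt ℝ ∞ Γ x) (hsymm : ∀ x ∈ V, ∀ u w, Γ x u w = Γ x w u)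
    (hrad : ∀ x ∈ V, Γ x x x = 0) : Γ 0 = 0 := by
  have hdiag (v : E) : Γ 0 v v = 0 := by
    have hd := hasDerivAt_comp_line ((hΓ 0 h0).differentiableAt (by simp)) v
    have hc := (((hd.clm_apply (hasDerivAt_const 0 v)).clm_apply
      (hasDerivAt_const 0 v)).continuousAt.tendsto).mono_left
      (nhdsWithin_le_nhds (s := {0}ᶜ))
    -- For `t ≠ 0`, divide `Γ_{tv}(tv, tv) = 0` by `t²`; the value at `0` follows by continuity, and
    -- then polarization gives `Γ 0 = 0`.
    have hz : (fun t : ℝ ↦ Γ (0 + t • v) v v) =ᶠ[𝓝[≠] 0] fun _ ↦ 0 := by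
      filter_upwards [nhdsWithin_le_nhds (eventually_line (hV.mem_nhds h0) v),
        self_mem_nhdsWithin] with t ht ht0
      have h := hrad _ ht
      rw [zero_add] at h ⊢
      have h' : t • t • Γ (t • v) v v = 0 := by
        rw [← h, map_smul, map_smul, smul_apply]
      simpa [show t ≠ 0 from ht0] using h'
    have := tendsto_nhds_unique (hc.congr' hz) tendsto_const_nhds
    simpa using this
  ext u w
  have h1 := hdiag (u + w)
  rw [map_add, map_add, add_apply, add_apply, hdiag, hdiag, hsymm 0 h0 w u] at h1
  have h2 : (2 : ℝ) • Γ 0 u w = 0 := by rw [two_smul]; simpa using h1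
  simpa using h2

/-- The radial derivative identity for Christoffel symbols in normal coordinates. -/
theorem fderiv_christoffel_radial (hV : IsOpen V)
    (hΓ : ∀ x ∈ V, ContDiffAt ℝ ∞ Γ x) (hsymm : ∀ x ∈ V, ∀ u w, Γ x u w = Γ x w u)
    (hrad : ∀ x ∈ V, Γ x x x = 0) {X : E} {t : ℝ} (ht : t ≠ 0) (hx : t • X ∈ V) (v : E) :
    fderiv ℝ Γ (t • X) v X X = -((2 / t) • Γ (t • X) X v) := by
  have hd := hasDerivAt_comp_line ((hΓ _ hx).differentiableAt (by simp)) v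
  have hi : HasDerivAt (fun s : ℝ ↦ t • X + s • v) v 0 := by
    simpa using ((hasDerivAt_id (0 : ℝ)).smul_const v).const_add (t • X)
  have h1 := (hd.clm_apply hi).clm_apply hi
  -- Differentiating `Γ_y(y, y) = 0` at `y = tX` in the direction `v` gives `t² (∂_v Γ)(X, X) + 2t
  -- Γ(X, v) = 0`; then divide by `t²`.
  have h2 : (fun s : ℝ ↦ Γ (t • X + s • v) (t • X + s • v) (t • X + s • v)) =ᶠ[𝓝 0]
      fun _ ↦ 0 := by
    filter_upwards [eventually_line (hV.mem_nhds hx) v] with s hs using hrad _ hs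
  have h3 := (h1.congr_of_eventuallyEq h2.symm).unique (hasDerivAt_const 0 (0 : E))
  simp only [zero_smul, add_zero, add_apply, map_smul, smul_apply] at h3
  rw [hsymm _ hx v X] at h3
  have h4 : t • t • (fderiv ℝ Γ (t • X) v X X + (2 / t) • Γ (t • X) X v) = 0 := by
    rw [smul_add, smul_add, smul_smul t (2 / t), mul_div_cancel₀ _ ht, ← h3]
    module
  rw [smul_eq_zero_iff_right ht, smul_eq_zero_iff_right ht] at h4
  exact eq_neg_of_add_eq_zero_left h4

/-- In `R(X, v)X` the radial identity turns `-(∂_v Γ)(X, X)` into `(2/t) Γ(X, v)`, and `Γ(X, X) = 0`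
removes the last term. What remains is two traces linear in `Γ`, whose parity is known, and a
quadratic one. -/
theorem ricciOf_radial (hV : IsOpen V)
    (hΓ : ∀ x ∈ V, ContDiffAt ℝ ∞ Γ x) (hsymm : ∀ x ∈ V, ∀ u w, Γ x u w = Γ x w u)
    (hrad : ∀ x ∈ V, Γ x x x = 0) {X : E} {t : ℝ} (ht : t ≠ 0) (hx : t • X ∈ V) :
    ricciOf Γ (t • X) X X = traceL E (fderiv ℝ Γ (t • X) X X) +
      2 / t * traceL E (Γ (t • X) X) + traceL E (Γ (t • X) X ∘L Γ (t • X) X) := by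
  have h0 : Γ (t • X) X X = 0 := by
    have h := hrad _ hx
    rw [map_smul, map_smul, smul_apply, smul_eq_zero_iff_right ht,
      smul_eq_zero_iff_right ht] at h
    exact h
  have h : curvatureOf Γ (t • X) X X = fderiv ℝ Γ (t • X) X X +
      (2 / t) • Γ (t • X) X + Γ (t • X) X ∘L Γ (t • X) X := by
    ext v
    rw [curvatureOf_apply, fderiv_christoffel_radial hV hΓ hsymm hrad ht hx, h0,
      hsymm _ hx _ X, map_zero, zero_apply, sub_neg_eq_add, sub_zero]
    rfl
  rw [ricciOf_apply, h, map_add, map_add, map_smul, smul_eq_mul]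

/-- In even normal coordinates the Ricci form has vanishing radial derivative at the origin. -/
theorem fderiv_ricciOf_radial (hV : IsOpen V) (h0 : (0 : E) ∈ V) (hneg : ∀ x ∈ V, -x ∈ V)
    (hΓ : ∀ x ∈ V, ContDiffAt ℝ ∞ Γ x) (hsymm : ∀ x ∈ V, ∀ u w, Γ x u w = Γ x w u)
    (hrad : ∀ x ∈ V, Γ x x x = 0)
    (hβ : ∀ x ∈ V, ContDiffAt ℝ ∞ β x) (hnd : ∀ x ∈ V, ∀ u, (∀ v, β x u v = 0) → u = 0)
    (hpar : ∀ x ∈ V, ∀ w u v, fderiv ℝ β x w u v = β x (Γ x w u) v + β x u (Γ x w v))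
    (heven : ∀ x ∈ V, β (-x) = β x) (X : E) : fderiv ℝ (ricciOf Γ) 0 X X X = 0 := by
  have hodd {x : E} (hx : x ∈ V) := traceL_christoffel_neg hV hneg hβ hnd hpar heven hx X
  have htd {x : E} (hx : x ∈ V) : DifferentiableAt ℝ (fun x ↦ traceL E (Γ x X)) x := by
    have hd : DifferentiableAt ℝ (fun x ↦ Γ x X) x :=
      ((hΓ x hx).differentiableAt (by simp)).clm_apply (differentiableAt_const X)
    exact ((traceL E).hasFDerivAt.comp x hd.hasFDerivAt).differentiableAt
  have hfd {x : E} (hx : x ∈ V) (w : E) :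
      fderiv ℝ (fun x ↦ traceL E (Γ x X)) x w = traceL E (fderiv ℝ Γ x w X) := by
    have hd := (hΓ x hx).differentiableAt (by simp)
    have h1 := (hasDerivAt_comp_line hd w).clm_apply (hasDerivAt_const (0 : ℝ) X)
    have h2 := (traceL E).hasFDerivAt.comp_hasDerivAt (0 : ℝ) h1
    refine ((hasDerivAt_comp_line (htd hx) w).unique h2).trans ?_
    rw [map_zero, add_zero]
  have heven' {x : E} (hx : x ∈ V) :
      traceL E (fderiv ℝ Γ (-x) X X) = traceL E (fderiv ℝ Γ x X X) := by
    rw [← hfd hx, ← hfd (hneg x hx)]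
    have h1 : (fun y ↦ traceL E (Γ (-y) X)) =ᶠ[𝓝 x] -(fun y ↦ traceL E (Γ y X)) := by
      filter_upwards [hV.mem_nhds hx] with y hy using hodd hy
    have h2 := congr($(h1.fderiv_eq (𝕜 := ℝ)) X)
    rw [fderiv_comp_neg_apply (f := fun y ↦ traceL E (Γ y X)) (htd (hneg x hx)), fderiv_neg,
      neg_apply, neg_inj] at h2
    exact h2
  -- A product of two factors that vanish at `0`.
  have hquad (Y : E) : HasDerivAt
      (fun t : ℝ ↦ traceL E (Γ (0 + t • Y) X ∘L Γ (0 + t • Y) X)) 0 0 := by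
    have h1 := (hasDerivAt_comp_line ((hΓ 0 h0).differentiableAt (by simp)) Y).clm_apply
      (hasDerivAt_const 0 X)
    have h2 := (traceL E).hasFDerivAt.comp_hasDerivAt 0 (h1.clm_comp h1)
    refine h2.congr_deriv ?_
    rw [zero_smul, add_zero, christoffel_zero hV h0 hΓ hsymm hrad]
    simp only [zero_apply, ContinuousLinearMap.comp_zero, ContinuousLinearMap.zero_comp, add_zero,
      map_zero]
  have hric (Y : E) : HasDerivAt (fun t : ℝ ↦ ricciOf Γ (0 + t • Y) X X)
      (fderiv ℝ (ricciOf Γ) 0 Y X X) 0 := by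
    have h := ((hasDerivAt_comp_line ((contDiffAt_ricciOf (hΓ 0 h0)).differentiableAt (by simp))
      Y).clm_apply (hasDerivAt_const 0 X)).clm_apply (hasDerivAt_const 0 X)
    simpa only [map_zero, add_zero] using h
  -- Comparing the rays along `X` and `-X` cancels the even part. The case `t = 0` is separate
  -- because of the factor `2 / t`.
  have hdiff : (fun t : ℝ ↦ ricciOf Γ (0 + t • X) X X - ricciOf Γ (0 + t • -X) X X) =ᶠ[𝓝 0]
      fun t ↦ traceL E (Γ (0 + t • X) X ∘L Γ (0 + t • X) X) -
        traceL E (Γ (0 + t • -X) X ∘L Γ (0 + t • -X) X) := by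
    filter_upwards [eventually_line (hV.mem_nhds h0) X] with t ht
    rcases eq_or_ne t 0 with rfl | ht0
    · simp
    have ht : t • X ∈ V := by rwa [zero_add] at ht
    have ht' : (-t) • X ∈ V := by simpa using hneg _ ht
    simp only [zero_add, smul_neg, ← neg_smul t X]
    rw [ricciOf_radial hV hΓ hsymm hrad ht0 ht,
      ricciOf_radial hV hΓ hsymm hrad (neg_ne_zero.2 ht0) ht', neg_smul, heven' ht, hodd ht]
    ring
  have h := (((hric X).sub (hric (-X))).congr_of_eventuallyEq hdiff.symm).unique
    ((hquad X).sub (hquad (-X)))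
  have e : fderiv ℝ (ricciOf Γ) 0 (-X) X X = -fderiv ℝ (ricciOf Γ) 0 X X X := by
    rw [map_neg]; rfl
  rw [e] at h
  linarith

end FlatSymmetry

/-! ### Transfer to the manifold through symmetric normal coordinates. -/

section Symmetry

variable {E : Type*} [NormedAddCommGroup E] [NormedSpace ℝ E] [FiniteDimensional ℝ E]
  {M : Type*} [TopologicalSpace M] [ChartedSpace E M] [IsManifold 𝓘(ℝ, E) ∞ M]
  {φ : PartialDiffeomorph 𝓘(ℝ, E) 𝓘(ℝ, E) E M ∞} {x : E}
  {cov : CovariantDerivative 𝓘(ℝ, E) E (TangentSpace 𝓘(ℝ, E) : M → Type _)}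
  {Ω : Π x : M, TangentSpace 𝓘(ℝ, E) x →L[ℝ] TangentSpace 𝓘(ℝ, E) x →L[ℝ] ℝ}

/-- The expression of a 2-form in a local parametrization, as a continuous bilinear form. -/
def coordFormL (φ : PartialDiffeomorph 𝓘(ℝ, E) 𝓘(ℝ, E) E M ∞)
    (Ω : Π x : M, TangentSpace 𝓘(ℝ, E) x →L[ℝ] TangentSpace 𝓘(ℝ, E) x →L[ℝ] ℝ) (x : E) :
    E →L[ℝ] E →L[ℝ] ℝ :=
  (LinearMap.mk₂ ℝ (coordForm φ Ω x)
    (fun u u' w ↦ by simp only [coordForm, map_add, add_apply])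
    (fun c u w ↦ by simp only [coordForm, map_smul, smul_apply])
    (fun u w w' ↦ by simp only [coordForm, map_add])
    (fun c u w ↦ by simp only [coordForm, map_smul])).toContinuousBilinearMap

theorem contDiffAt_coordFormL (hΩ : IsSymplecticForm Ω) (hx : x ∈ φ.source) :
    ContDiffAt ℝ ∞ (coordFormL φ Ω) x :=
  contDiffAt_clm fun u ↦ contDiffAt_clm fun v ↦ contDiffAt_coordForm hΩ hx u v

theorem coordFormL_nondegenerate (hΩ : IsSymplecticForm Ω) (hx : x ∈ φ.source) (u : E)
    (hu : ∀ v, coordFormL φ Ω x u v = 0) : u = 0 := by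
  refine paramDeriv_injective hx ((hΩ.nondegenerate _ _ fun v ↦ ?_).trans (map_zero _).symm)
  have hv : paramDeriv φ x ((paramDeriv φ x).inverse v) = v :=
    (isInvertible_mfderiv_param hx).self_apply_inverse _
  rw [← hv]
  exact hu _

theorem fderiv_coordFormL [T2Space M] [cov.ContMDiffCovariantDerivative ∞]
    (hΩ : IsSymplecticForm Ω) (hcov : IsSymplecticConnection Ω cov) (hx : x ∈ φ.source)
    (w u v : E) :
    fderiv ℝ (coordFormL φ Ω) x w u v =
      coordFormL φ Ω x (christoffel φ cov x w u) v +
        coordFormL φ Ω x u (christoffel φ cov x w v) := by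
  have h := fderiv_coordForm cov hΩ hcov hx u v w
  rw [christoffel_symm cov hcov.torsion_eq_zero hx u w,
    christoffel_symm cov hcov.torsion_eq_zero hx v w] at h
  refine Eq.trans ?_ h
  have h1 := ((hasDerivAt_comp_line ((contDiffAt_coordFormL hΩ hx).differentiableAt (by simp))
    w).clm_apply (hasDerivAt_const (0 : ℝ) u)).clm_apply (hasDerivAt_const (0 : ℝ) v)
  have h2 := hasDerivAt_comp_line (differentiableAt_coordForm hΩ hx u v) w
  have h3 := h1.unique h2
  simpa only [map_zero, add_zero] using h3

theorem apply_eq_of_base_eq {q q' : M} (h : q = q') {u v : TangentSpace 𝓘(ℝ, E) q}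
    {u' v' : TangentSpace 𝓘(ℝ, E) q'} (hu : (u : E) = u') (hv : (v : E) = v') :
    Ω q u v = Ω q' u' v' := by
  subst h
  subst hu
  subst hv
  rfl

namespace NormalNeighborhood

variable {p : M} (N : NormalNeighborhood cov p)

theorem geodesicSymmetry_param (hx : x ∈ N.diffeo.source) :
    N.geodesicSymmetry (N.diffeo x) = N.diffeo (-x) :=
  congrArg (fun y : E ↦ N.diffeo (-y)) (N.diffeo.left_inv hx)

theorem mfderiv_geodesicSymmetry (hN : N.IsSymmetric) (hx : x ∈ N.diffeo.source) (u : E) :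
    (mfderiv 𝓘(ℝ, E) 𝓘(ℝ, E) N.geodesicSymmetry (N.diffeo x) (paramDeriv N.diffeo x u) : E) =
      paramDeriv N.diffeo (-x) (-u) := by
  have hsymm := (contMDiffAt_param_symm hx).mdifferentiableAt (by simp : (∞ : ℕ∞ω) ≠ 0)
  have hleft : N.diffeo.symm (N.diffeo x) = x := N.diffeo.left_inv hx
  have hneg : MDifferentiableAt 𝓘(ℝ, E) 𝓘(ℝ, E) (fun y : E ↦ -y) x :=
    ((hasFDerivAt_id (𝕜 := ℝ) x).neg).differentiableAt.mdifferentiableAt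
  have hd : MDifferentiableAt 𝓘(ℝ, E) 𝓘(ℝ, E) N.diffeo (-x) :=
    (contMDiffAt_param (hN x hx)).mdifferentiableAt (by simp)
  have hd' : MDifferentiableAt 𝓘(ℝ, E) 𝓘(ℝ, E) (fun y : E ↦ N.diffeo (-y)) x :=
    MDifferentiableAt.comp x hd hneg
  have hs : MDifferentiableAt 𝓘(ℝ, E) 𝓘(ℝ, E) N.geodesicSymmetry (N.diffeo x) :=
    MDifferentiableAt.comp (g := fun y : E ↦ N.diffeo (-y)) (N.diffeo x) (hleft.symm ▸ hd') hsymm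
  have hx' : MDifferentiableAt 𝓘(ℝ, E) 𝓘(ℝ, E) N.diffeo x :=
    (contMDiffAt_param hx).mdifferentiableAt (by simp)
  have h1 := mfderiv_comp x hs hx'
  have h2 := mfderiv_comp x hd hneg
  have h3 : (N.geodesicSymmetry ∘ N.diffeo) =ᶠ[𝓝 x] (N.diffeo ∘ fun y : E ↦ -y) := by
    filter_upwards [N.diffeo.open_source.mem_nhds hx] with z hz using N.geodesicSymmetry_param hz
  have h4 := h3.mfderiv_eq (I := 𝓘(ℝ, E)) (I' := 𝓘(ℝ, E))
  have h5 : mfderiv 𝓘(ℝ, E) 𝓘(ℝ, E) (fun y : E ↦ -y) x u = -u := by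
    rw [mfderiv_eq_fderiv]
    refine congr($((hasFDerivAt_id x).neg.fderiv) u).trans ?_
    rfl
  have h6 : (mfderiv 𝓘(ℝ, E) 𝓘(ℝ, E) (N.geodesicSymmetry ∘ N.diffeo) x : E →L[ℝ] E) u =
    (mfderiv 𝓘(ℝ, E) 𝓘(ℝ, E) (N.diffeo ∘ fun y : E ↦ -y) x : E →L[ℝ] E) u := congr($h4 u)
  have h7 := congr($h1 u)
  have h8 := congr($h2 u)
  refine h7.symm.trans (h6.trans (h8.trans ?_))
  exact congrArg (paramDeriv N.diffeo (-x)) h5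

/-- In symmetric normal coordinates, a form invariant under the geodesic symmetry is even. -/
theorem coordFormL_neg (hN : N.IsSymmetric)
    (hS : ∀ q ∈ N.diffeo.target, ∀ u v : TangentSpace 𝓘(ℝ, E) q,
      Ω (N.geodesicSymmetry q)
        (mfderiv 𝓘(ℝ, E) 𝓘(ℝ, E) N.geodesicSymmetry q u)
        (mfderiv 𝓘(ℝ, E) 𝓘(ℝ, E) N.geodesicSymmetry q v) = Ω q u v)
    (hx : x ∈ N.diffeo.source) : coordFormL N.diffeo Ω (-x) = coordFormL N.diffeo Ω x := by
  ext u v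
  have h := hS (N.diffeo x) (N.diffeo.map_source hx) (paramDeriv N.diffeo x u)
    (paramDeriv N.diffeo x v)
  refine Eq.trans ?_ h
  refine Eq.trans ?_ (apply_eq_of_base_eq (Ω := Ω) (N.geodesicSymmetry_param hx)
    (N.mfderiv_geodesicSymmetry hN hx u) (N.mfderiv_geodesicSymmetry hN hx v)).symm
  change coordFormL N.diffeo Ω (-x) u v = coordFormL N.diffeo Ω (-x) (-u) (-v)
  rw [map_neg, map_neg, neg_apply, neg_neg]

end NormalNeighborhood

theorem ricci_paramDeriv_eq_ricciOf [T2Space M] [cov.ContMDiffCovariantDerivative ∞]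
    (hx : x ∈ φ.source) (u w : E) :
    ricci cov (φ x) (paramDeriv φ x u) (paramDeriv φ x w) = ricciOf (christoffel φ cov) x u w :=
  ricci_paramDeriv cov hx u w

/-- Where the Christoffel symbols vanish, the covariant derivative of the Ricci tensor is the
derivative of its expression. -/
theorem covDerivRicci_eq [T2Space M] [cov.ContMDiffCovariantDerivative ∞] (hx : x ∈ φ.source)
    (hΓ : christoffel φ cov x = 0) {X Y Z : Π y : M, TangentSpace 𝓘(ℝ, E) y}
    (hY : CMDiff ∞ (T% Y)) (hZ : CMDiff ∞ (T% Z)) :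
    covDerivRicci cov X Y Z (φ x) = fderiv ℝ (ricciOf (christoffel φ cov)) x
      (coordField φ X x) (coordField φ Y x) (coordField φ Z x) := by
  have hYm := (hY (φ x)).mdifferentiableAt (by simp)
  have hZm := (hZ (φ x)).mdifferentiableAt (by simp)
  have hYd := differentiableAt_coordField hx hYm
  have hZd := differentiableAt_coordField hx hZm
  have hR := (contDiffAt_ricciOf (contDiffAt_christoffel cov hx)).differentiableAt (by simp)
  have hd : DifferentiableAt ℝ (fun z ↦ ricciOf (christoffel φ cov) z
      (coordField φ Y z) (coordField φ Z z)) x := (hR.clm_apply hYd).clm_apply hZd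
  have h1 := mvfderiv_paramDeriv hx (g := fun y ↦ ricci cov y (Y y) (Z y)) hd (by
    filter_upwards [φ.open_source.mem_nhds hx] with z hz
    rw [← ricci_paramDeriv_eq_ricciOf hz, paramDeriv_coordField hz, paramDeriv_coordField hz])
    (coordField φ X x)
  have h2 := (hasDerivAt_comp_line hd (coordField φ X x)).unique
    (((hasDerivAt_comp_line hR _).clm_apply (hasDerivAt_comp_line hYd _)).clm_apply
      (hasDerivAt_comp_line hZd _))
  -- With `Γ = 0` at the point, `∇_X Y` is the derivative of the components, so the correction terms
  -- cancel those of the product rule.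
  have hc {Y : Π y : M, TangentSpace 𝓘(ℝ, E) y} (hY : MDiffAt (T% Y) (φ x)) :
      cov Y (φ x) (X (φ x)) =
        paramDeriv φ x (fderiv ℝ (coordField φ Y) x (coordField φ X x)) := by
    rw [← paramDeriv_coordField hx X, cov_paramDeriv cov hx hY, hΓ, zero_apply, zero_apply,
      add_zero]
  rw [covDerivRicci, hc hYm, hc hZm, ← paramDeriv_coordField hx X, ← paramDeriv_coordField hx Y,
    ← paramDeriv_coordField hx Z, ricci_paramDeriv_eq_ricciOf hx, ricci_paramDeriv_eq_ricciOf hx]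
  rw [paramDeriv_coordField hx X] at h1 ⊢
  rw [h1, h2]
  simp only [zero_smul, add_zero, add_apply]
  ring

/-- A trilinear form that is symmetric in the last two arguments and vanishes on the diagonal has
vanishing cyclic sum. -/
theorem cyclic_sum_eq_zero {T : E →L[ℝ] E →L[ℝ] E →L[ℝ] ℝ} (hsymm : ∀ u v w, T u v w = T u w v)
    (hdiag : ∀ u, T u u u = 0) (u v w : E) : T u v w + T v w u + T w u v = 0 := by
  have hadd (a b c d : E) : T (a + b) c d = T a c d + T b c d := by rw [map_add]; rfl
  have hadd' (a b c d : E) : T a (b + c) d = T a b d + T a c d := by rw [map_add]; rfl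
  have hadd'' (a b c d : E) : T a b (c + d) = T a b c + T a b d := map_add ..
  -- Inclusion–exclusion over these sums isolates the sum of `T` over all six orders of `u, v, w`;
  -- symmetry makes it twice the cyclic sum.
  have h1 := hdiag (u + v + w)
  have h2 := hdiag (u + v)
  have h3 := hdiag (v + w)
  have h4 := hdiag (u + w)
  simp only [hadd, hadd', hadd'', hdiag] at h1 h2 h3 h4
  linarith [hsymm u w v, hsymm v u w, hsymm w v u]

/-- `T` is the derivative of the Ricci form at the origin of normal coordinates at `p`, and `a`
reads a field's components there. The cyclic identity is thereby reduced to algebra of one trilinear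
form. -/
theorem covDerivRicci_of_isTypeS [T2Space M] [cov.ContMDiffCovariantDerivative ∞]
    (hΩ : IsSymplecticForm Ω) (hcov : IsSymplecticConnection Ω cov) (hS : IsTypeS Ω cov) (p : M) :
    ∃ (T : E →L[ℝ] E →L[ℝ] E →L[ℝ] ℝ) (a : (Π y : M, TangentSpace 𝓘(ℝ, E) y) → E),
      (∀ u v w, T u v w = T u w v) ∧ (∀ u, T u u u = 0) ∧
      ∀ X Y Z : Π y : M, TangentSpace 𝓘(ℝ, E) y, CMDiff ∞ (T% Y) → CMDiff ∞ (T% Z) →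
        covDerivRicci cov X Y Z p = T (a X) (a Y) (a Z) := by
  obtain ⟨N, hN, hN'⟩ := hS p
  have hV := N.diffeo.open_source
  have hΓ : ∀ x ∈ N.diffeo.source, ContDiffAt ℝ ∞ (christoffel N.diffeo cov) x :=
    fun x hx ↦ contDiffAt_christoffel cov hx
  have hsymm : ∀ x ∈ N.diffeo.source, ∀ u w, christoffel N.diffeo cov x u w =
      christoffel N.diffeo cov x w u :=
    fun x hx u w ↦ christoffel_symm cov hcov.torsion_eq_zero hx u w
  have hrad : ∀ x ∈ N.diffeo.source, christoffel N.diffeo cov x x x = 0 :=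
    fun x hx ↦ N.christoffel_self hx
  have hβ : ∀ x ∈ N.diffeo.source, ContDiffAt ℝ ∞ (coordFormL N.diffeo Ω) x :=
    fun x hx ↦ contDiffAt_coordFormL hΩ hx
  have hnd : ∀ x ∈ N.diffeo.source, ∀ u, (∀ v, coordFormL N.diffeo Ω x u v = 0) → u = 0 :=
    fun x hx ↦ coordFormL_nondegenerate hΩ hx
  have hpar := fun x (hx : x ∈ N.diffeo.source) ↦ fderiv_coordFormL hΩ hcov hx
  have h0 := N.zero_mem
  refine ⟨fderiv ℝ (ricciOf (christoffel N.diffeo cov)) 0, fun X ↦ coordField N.diffeo X 0,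
    fun u v w ↦ ?_, fderiv_ricciOf_radial hV h0 hN hΓ hsymm hrad hβ hnd hpar
      fun x hx ↦ N.coordFormL_neg hN hN' hx, fun X Y Z hY hZ ↦ ?_⟩
  · have hR := (contDiffAt_ricciOf (hΓ 0 h0)).differentiableAt (by simp)
    have h (v w : E) := ((hasDerivAt_comp_line hR u).clm_apply
      (hasDerivAt_const (0 : ℝ) v)).clm_apply (hasDerivAt_const (0 : ℝ) w)
    have h' : (fun t : ℝ ↦ ricciOf (christoffel N.diffeo cov) (0 + t • u) v w) =ᶠ[𝓝 0]
        fun t ↦ ricciOf (christoffel N.diffeo cov) (0 + t • u) w v := by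
      filter_upwards [eventually_line (hV.mem_nhds h0) u] with t ht using
        ricciOf_symm hV hΓ hsymm hβ hnd hpar ht v w
    have h'' := ((h v w).congr_of_eventuallyEq h'.symm).unique (h w v)
    simpa only [map_zero, add_zero] using h''
  · rw [← covDerivRicci_eq h0 (christoffel_zero hV h0 hΓ hsymm hrad) hY hZ, N.diffeo_zero]

end Symmetry

end

end SymplecticConnection

/-! ### The theorem, by polarization at each point. -/

open SymplecticConnection in
theorem mainTheorem6 {E : Type*} [NormedAddCommGroup E] [NormedSpace ℝ E] [FiniteDimensional ℝ E]
    {M : Type*} [TopologicalSpace M] [T2Space M] [ChartedSpace E M] [IsManifold 𝓘(ℝ, E) ∞ M]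
    (Ω : Π x : M, TangentSpace 𝓘(ℝ, E) x →L[ℝ] TangentSpace 𝓘(ℝ, E) x →L[ℝ] ℝ)
    (hΩ : IsSymplecticForm Ω)
    (cov : CovariantDerivative 𝓘(ℝ, E) E (TangentSpace 𝓘(ℝ, E) : M → Type _))
    [cov.ContMDiffCovariantDerivative ∞]
    (hcov : IsSymplecticConnection Ω cov)
    (hS : IsTypeS Ω cov) :
    IsPreferred cov ∧
      ∀ X : Π x : M, TangentSpace 𝓘(ℝ, E) x, CMDiff ∞ (T% X) →
        ∀ x : M, covDerivRicci cov X X X x = 0 := by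
  constructor
  · intro X Y Z hX hY hZ x
    obtain ⟨T, a, hsymm, hdiag, hT⟩ := covDerivRicci_of_isTypeS hΩ hcov hS x
    rw [hT X Y Z hY hZ, hT Y Z X hZ hX, hT Z X Y hX hY]
    exact cyclic_sum_eq_zero hsymm hdiag _ _ _
  · intro X hX x
    obtain ⟨T, a, -, hdiag, hT⟩ := covDerivRicci_of_isTypeS hΩ hcov hS x
    rw [hT X X X hX hX, hdiag]
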